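/- All graphs are finite and simple. For a clique $\sigma$ of a graph $G$, the link $\mathrm{lk}_G\sigma$ is the subgraph of $G$ induced by the vertices that are adjacent to every vertex of $\sigma$. A graph $G$ with $n$ vertices and $m$ edges is called fascinating if (a) $G$ contains exactly $2(m-n)$ triangles; (b) for every edge $e$ of $G$, the link $\mathrm{lk}_G e$ is a cycle of length at least $4$; (c) for every triangle $t$ of $G$, the link $\mathrm{lk}_G t$ is the graph with two vertices and no edges; (d) for every vertex $v$ of $G$, the link $\mathrm{lk}_G v$ is connected, has at least $6$ vertices, and is a planar graph that can be drawn in the plane without crossings so that every face (including the unbounded one) is bounded by a triangle. The join of two graphs is their disjoint union together with all edges between them. Theorem. There exists a number $n_0$ such that every fascinating graph $G$ with $n\ge n_0$ vertices and $m>\frac14(n^2+2n+17)$ edges is (isomorphic to) a join of two cycles. -/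

import Mathlib

namespace FlagGraph

/-- The vertices of the link of `σ`: those adjacent to every vertex of `σ`. -/
def linkVerts {V : Type*} (G : SimpleGraph V) (σ : Set V) : Set V :=
  {w | ∀ v ∈ σ, G.Adj v w}

/-- The link of `σ` in `G`: the subgraph induced by the common neighbours of `σ`. -/
def link {V : Type*} (G : SimpleGraph V) (σ : Set V) : SimpleGraph (linkVerts G σ) :=
  G.induce (linkVerts G σ)

/-- `G` is a cycle with at least `k` vertices (cycles have at least three vertices). -/
def IsCycleOfLengthAtLeast {V : Type*} (G : SimpleGraph V) (k : ℕ) : Prop :=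
  ∃ l : ℕ, 3 ≤ l ∧ k ≤ l ∧ Nonempty (G ≃g SimpleGraph.cycleGraph l)

/-- The join of two graphs: their disjoint union together with all edges between them. -/
def join {V W : Type*} (G : SimpleGraph V) (H : SimpleGraph W) : SimpleGraph (V ⊕ W) :=
  SimpleGraph.sum G H ⊔ completeBipartiteGraph V W

/-- `G` is isomorphic to a join of two cycles. -/
def IsJoinOfTwoCycles {V : Type*} (G : SimpleGraph V) : Prop :=
  ∃ k l : ℕ, 3 ≤ k ∧ 3 ≤ l ∧
    Nonempty (G ≃g join (SimpleGraph.cycleGraph k) (SimpleGraph.cycleGraph l))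

/-- The Euclidean plane. -/
abbrev Plane : Type := EuclideanSpace ℝ (Fin 2)

/-- A drawing of `G` in the plane without crossings: vertices are distinct points, an edge is a
simple arc between its ends, an arc contains no vertex other than its ends, and distinct arcs meet
only in vertices. -/
structure PlaneDrawing {V : Type*} (G : SimpleGraph V) where
  point : V → Plane
  arc : G.edgeSet → Set Plane
  point_injective : Function.Injective point
  exists_path : ∀ (u v : V) (h : G.Adj u v), ∃ γ : Path (point u) (point v),
    Function.Injective γ ∧ Set.range γ = arc ⟨s(u, v), h⟩
  mem_of_point_mem_arc : ∀ (w : V) (e : G.edgeSet), point w ∈ arc e → w ∈ (e : Sym2 V)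
  arc_inter_arc : ∀ e f : G.edgeSet, e ≠ f → arc e ∩ arc f ⊆ Set.range point

namespace PlaneDrawing

variable {V : Type*} {G : SimpleGraph V}

/-- The point set of the drawing. -/
def support (D : PlaneDrawing G) : Set Plane :=
  Set.range D.point ∪ ⋃ e, D.arc e

/-- The faces of the drawing, among them the unbounded one: the connected components of the
complement of its point set. -/
def IsFace (D : PlaneDrawing G) (F : Set Plane) : Prop :=
  ∃ x ∈ D.supportᶜ, F = connectedComponentIn D.supportᶜ x

/-- The boundary of `F` consists of the three arcs of a triangle of `G`. -/
def IsBoundedByTriangle (D : PlaneDrawing G) (F : Set Plane) : Prop :=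
  ∃ (a b c : V) (hab : G.Adj a b) (hbc : G.Adj b c) (hca : G.Adj c a),
    frontier F = D.arc ⟨s(a, b), hab⟩ ∪ D.arc ⟨s(b, c), hbc⟩ ∪ D.arc ⟨s(c, a), hca⟩

end PlaneDrawing

/-- `G` can be drawn in the plane so that every face, including the unbounded one, is a triangle. -/
def IsPlanarWithTriangularFaces {V : Type*} (G : SimpleGraph V) : Prop :=
  ∃ D : PlaneDrawing G, ∀ F : Set Plane, D.IsFace F → D.IsBoundedByTriangle F

/-- Fascinating graphs. -/
structure IsFascinating {V : Type*} [Fintype V] [DecidableEq V] (G : SimpleGraph V)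
    [DecidableRel G.Adj] : Prop where
  card_triangles : ((G.cliqueFinset 3).card : ℤ) =
    2 * ((G.edgeFinset.card : ℤ) - (Fintype.card V : ℤ))
  edge_link : ∀ u v : V, G.Adj u v → IsCycleOfLengthAtLeast (link G {u, v}) 4
  triangle_link : ∀ t : Finset V, G.IsNClique 3 t →
    (linkVerts G (t : Set V)).ncard = 2 ∧ link G (t : Set V) = ⊥
  vertex_link_connected : ∀ v : V, (link G {v}).Connected
  vertex_link_planar : ∀ v : V, IsPlanarWithTriangularFaces (link G {v})
  vertex_link_card : ∀ v : V, 6 ≤ (linkVerts G {v}).ncard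

end FlagGraph

/-!
Modulo-two homology shows that a vertex link with `d` vertices has at least `3 * d - 6` edges, and
the number of triangles of `G` forces equality everywhere. So every vertex link is a triangulated
sphere, and a two-colouring of its vertices has at most `2 * d - 4` bichromatic edges, with equality
if there is no monochromatic triangle.

By the Cauchy–Schwarz inequality some edge `uv` satisfies `|N u ∪ N v| ≥ n - 3`. Neighbourhoods span
only linearly many edges, so `G` is almost a balanced complete bipartite graph on sides `A` and `B`.
A vertex of `A` with three neighbours in `A` has too few bichromatic edges in its link unless about
`n / 2` edges between `A` and `B` are missing, more than the density of `G` affords. Hence both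
sides have inner degrees at most two, and for suitable `a ∈ A` and `b ∈ B` the sets `N a ∩ B` and
`N b ∩ A` are links of edges `aa'` and `bb'` which together contain all vertices except at most one.

If the two links cover `G`, then counting bichromatic edges in the vertex links shows that they are
completely joined. An exceptional vertex would cost so many edges between the two links that the
number of edges would be at most `(n ^ 2 + 2 * n + 17) / 4`.
-/

open Finset

namespace FlagGraph

/-! ### Counting adjacent pairs -/

section Counting

variable {V : Type*} {G : SimpleGraph V} [DecidableRel G.Adj]

/-- The number of neighbours of `x` in `S`. The vertices of `S` missed by `x ∉ S` are counted by
`degIn Gᶜ x S`. -/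
def degIn (G : SimpleGraph V) [DecidableRel G.Adj] (x : V) (S : Finset V) : ℕ :=
  #{y ∈ S | G.Adj x y}

theorem degIn_le_card (x : V) (S : Finset V) : degIn G x S ≤ #S := card_filter_le _ _

theorem degIn_mono {S T : Finset V} (h : S ⊆ T) (x : V) : degIn G x S ≤ degIn G x T :=
  card_le_card (filter_subset_filter _ h)

theorem card_interedges_eq_sum_degIn (S T : Finset V) :
    #(G.interedges S T) = ∑ x ∈ S, degIn G x T := by
  simp only [SimpleGraph.interedges, Rel.interedges, degIn, card_filter, sum_product]

theorem card_interedges_comm (S T : Finset V) : #(G.interedges S T) = #(G.interedges T S) :=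
  have := G.symm
  Rel.card_interedges_comm S T

theorem card_interedges_le_card_mul {S T : Finset V} {k : ℕ} (h : ∀ x ∈ S, degIn G x T ≤ k) :
    #(G.interedges S T) ≤ #S * k := by
  rw [card_interedges_eq_sum_degIn]
  exact sum_le_card_nsmul S _ k h

theorem card_mul_le_mul_card_interedges {S T : Finset V} {c k : ℕ}
    (h : ∀ x ∈ S, c ≤ k * degIn G x T) : #S * c ≤ k * #(G.interedges S T) := by
  rw [card_interedges_eq_sum_degIn, mul_sum, ← smul_eq_mul, ← sum_const]
  exact sum_le_sum h

theorem exists_degIn_le {S T : Finset V} {k : ℕ} (h : #(G.interedges S T) < #S * (k + 1)) :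
    ∃ x ∈ S, degIn G x T ≤ k := by
  by_contra! h_all
  have := card_nsmul_le_sum S (degIn G · T) (k + 1) h_all
  rw [smul_eq_mul, ← card_interedges_eq_sum_degIn] at this
  exact h.not_ge this

theorem degIn_le_card_interedges {x : V} {S : Finset V} (hx : x ∈ S) (T : Finset V) :
    degIn G x T ≤ #(G.interedges S T) := by
  rw [card_interedges_eq_sum_degIn]
  exact single_le_sum (f := fun x => degIn G x T) (fun _ _ => Nat.zero_le _) hx

section Fintype

variable [Fintype V]

theorem degIn_univ (x : V) : degIn G x univ = G.degree x := by
  rw [degIn, ← SimpleGraph.card_neighborFinset_eq_degree, SimpleGraph.neighborFinset_eq_filter]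

theorem degIn_le_degree (x : V) (S : Finset V) : degIn G x S ≤ G.degree x :=
  degIn_univ (G := G) x ▸ degIn_mono (subset_univ S) x

theorem card_interedges_univ : #(G.interedges univ univ) = 2 * #G.edgeFinset := by
  rw [card_interedges_eq_sum_degIn, sum_congr rfl fun x _ => degIn_univ x,
    G.sum_degrees_eq_twice_card_edges]

end Fintype

variable [DecidableEq V]

theorem degIn_union {S T : Finset V} (h : Disjoint S T) (x : V) :
    degIn G x (S ∪ T) = degIn G x S + degIn G x T := by
  rw [degIn, filter_union, card_union_of_disjoint (disjoint_filter_filter h), degIn, degIn]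

theorem degIn_le_add_card_sdiff (x : V) (S T : Finset V) :
    degIn G x S ≤ degIn G x T + #(S \ T) := by
  have h_sub : ({y ∈ S | G.Adj x y} : Finset V) ⊆ {y ∈ T | G.Adj x y} ∪ S \ T := by
    intro y
    simp only [mem_filter, mem_union, mem_sdiff]
    tauto
  exact (card_le_card h_sub).trans (card_union_le _ _)

theorem degIn_add_degIn_compl {x : V} {S : Finset V} (hx : x ∉ S) :
    degIn G x S + degIn Gᶜ x S = #S := by
  rw [← card_filter_add_card_filter_not (s := S) (G.Adj x), degIn, degIn]
  congr 2
  refine filter_congr fun y hy => ?_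
  simp only [SimpleGraph.compl_adj, ne_eq, (ne_of_mem_of_not_mem hy hx).symm, not_false_eq_true,
    true_and]

theorem card_interedges_union_left {S T : Finset V} (h : Disjoint S T) (U : Finset V) :
    #(G.interedges (S ∪ T) U) = #(G.interedges S U) + #(G.interedges T U) := by
  simp only [card_interedges_eq_sum_degIn, sum_union h]

theorem card_interedges_union_right {S T : Finset V} (h : Disjoint S T) (U : Finset V) :
    #(G.interedges U (S ∪ T)) = #(G.interedges U S) + #(G.interedges U T) := by
  rw [card_interedges_comm, card_interedges_union_left h, card_interedges_comm S,
    card_interedges_comm T]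

theorem degIn_eq_card_inter [Fintype V] (x : V) (S : Finset V) :
    degIn G x S = #(G.neighborFinset x ∩ S) := by
  rw [degIn, SimpleGraph.neighborFinset_eq_filter, filter_inter, univ_inter]

end Counting

/-! ### Triangles -/

section Triangles

variable {V : Type*} [Fintype V] [DecidableEq V] {G : SimpleGraph V} [DecidableRel G.Adj]

/-- The vertices of the link of the edge `uv`, when `u` and `v` are adjacent. -/
abbrev edgeLink (G : SimpleGraph V) [DecidableRel G.Adj] (u v : V) : Finset V :=
  G.neighborFinset u ∩ G.neighborFinset v

theorem mem_edgeLink {u v w : V} : w ∈ edgeLink G u v ↔ G.Adj u w ∧ G.Adj v w := by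
  simp only [mem_inter, SimpleGraph.mem_neighborFinset]

theorem edgeLink_comm (u v : V) : edgeLink G u v = edgeLink G v u := inter_comm _ _

theorem degIn_neighborFinset (u v : V) : degIn G u (G.neighborFinset v) = #(edgeLink G u v) :=
  degIn_eq_card_inter u _

theorem triangles_containing_pair {w x : V} (h : G.Adj w x) :
    {t ∈ G.cliqueFinset 3 | w ∈ t ∧ x ∈ t} = (edgeLink G w x).image fun y => {w, x, y} := by
  ext t
  simp only [mem_filter, SimpleGraph.mem_cliqueFinset_iff, mem_image, mem_edgeLink]
  constructor
  · rintro ⟨ht, hw, hx⟩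
    obtain ⟨y, hy⟩ : ∃ y, t \ {w, x} = {y} := by
      rw [← card_eq_one, card_sdiff_of_subset (insert_subset hw (singleton_subset_iff.2 hx)),
        card_pair h.ne, ht.card_eq]
    have hyt : y ∈ t ∧ y ≠ w ∧ y ≠ x := by
      have : y ∈ t \ {w, x} := hy ▸ mem_singleton_self y
      simpa only [mem_sdiff, mem_insert, mem_singleton, not_or] using this
    refine ⟨y, ⟨ht.isClique hw hyt.1 hyt.2.1.symm, ht.isClique hx hyt.1 hyt.2.2.symm⟩, ?_⟩
    grind
  · rintro ⟨y, ⟨hwy, hxy⟩, rfl⟩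
    exact ⟨SimpleGraph.is3Clique_triple_iff.2 ⟨h, hwy, hxy⟩, by simp, by simp⟩

theorem injOn_triangle (w x : V) :
    Set.InjOn (fun y => ({w, x, y} : Finset V)) (edgeLink G w x) := by
  intro y hy z _ (hyz : ({w, x, y} : Finset V) = {w, x, z})
  have hy := mem_edgeLink.1 (mem_coe.1 hy)
  have : y ∈ ({w, x, z} : Finset V) := hyz ▸ by simp
  simpa only [mem_insert, mem_singleton, hy.1.ne', hy.2.ne', false_or] using this

theorem card_triangles_containing_pair {w x : V} (h : G.Adj w x) :
    #{t ∈ G.cliqueFinset 3 | w ∈ t ∧ x ∈ t} = #(edgeLink G w x) := by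
  rw [triangles_containing_pair h, card_image_of_injOn (injOn_triangle w x)]

theorem card_interedges_neighborFinset (v : V) :
    #(G.interedges (G.neighborFinset v) (G.neighborFinset v)) =
      2 * #{t ∈ G.cliqueFinset 3 | v ∈ t} := by
  have h := sum_card_bipartiteAbove_eq_sum_card_bipartiteBelow
    (s := G.neighborFinset v) (t := {t ∈ G.cliqueFinset 3 | v ∈ t}) fun w t => w ∈ t
  simp only [bipartiteAbove, bipartiteBelow, filter_filter] at h
  rw [card_interedges_eq_sum_degIn, mul_comm, ← smul_eq_mul, ← sum_const]
  refine Eq.trans (sum_congr rfl fun w hw => ?_) (h.trans (sum_congr rfl fun t ht => ?_))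
  · rw [degIn_neighborFinset, edgeLink_comm,
      card_triangles_containing_pair ((SimpleGraph.mem_neighborFinset ..).1 hw)]
  · obtain ⟨ht, hv⟩ := mem_filter.1 ht
    rw [SimpleGraph.mem_cliqueFinset_iff] at ht
    have : {w ∈ G.neighborFinset v | w ∈ t} = t.erase v := by
      ext w
      simp only [mem_filter, SimpleGraph.mem_neighborFinset, mem_erase]
      exact ⟨fun h => ⟨h.1.ne', h.2⟩, fun h => ⟨ht.isClique hv h.2 h.1.symm, h.2⟩⟩
    rw [this, card_erase_of_mem hv, ht.card_eq]

theorem sum_card_interedges_neighborFinset :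
    ∑ v, #(G.interedges (G.neighborFinset v) (G.neighborFinset v)) = 6 * #(G.cliqueFinset 3) := by
  have h := sum_card_bipartiteAbove_eq_sum_card_bipartiteBelow
    (s := (univ : Finset V)) (t := G.cliqueFinset 3) fun v t => v ∈ t
  simp only [bipartiteAbove, bipartiteBelow, filter_univ_mem] at h
  rw [sum_congr rfl fun v _ => card_interedges_neighborFinset v, ← mul_sum, h,
    sum_const_nat fun t ht => ((SimpleGraph.mem_cliqueFinset_iff ..).1 ht).card_eq]
  lia

end Triangles

/-! ### Euler characteristic of connected surfaces -/

section Surfaces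

theorem card_le_rank_add_one {m n : Type*} [Fintype n] {K : Type*} [Field K]
    (M : Matrix m n K) (h : ∀ f : n → K, M.mulVec f = 0 → ∀ i j, f i = f j) :
    Fintype.card n ≤ M.rank + 1 := by
  classical
  have h_rank := LinearMap.finrank_range_add_finrank_ker M.mulVecLin
  rw [Module.finrank_fintype_fun_eq_card] at h_rank
  have h_ker : LinearMap.ker M.mulVecLin ≤ Submodule.span K {(fun _ => 1 : n → K)} := by
    intro f hf
    rw [Submodule.mem_span_singleton]
    rcases isEmpty_or_nonempty n with _ | ⟨⟨i⟩⟩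
    · exact ⟨0, Subsingleton.elim _ _⟩
    · exact ⟨f i, funext fun j => by simp [h f (by simpa using hf) i j]⟩
  have h_one := (Submodule.finrank_mono h_ker).trans (finrank_span_le_card _)
  simp only [Set.toFinset_singleton, card_singleton] at h_one
  unfold Matrix.rank
  lia

variable {W : Type*} {H : SimpleGraph W}

theorem eq_of_preconnected {β : Type*} {f : W → β} (hconn : H.Preconnected)
    (hf : ∀ u v, H.Adj u v → f u = f v) (u v : W) : f u = f v := by
  obtain ⟨p⟩ := hconn u v
  induction p with
  | nil => rfl
  | cons h _ ih => exact (hf _ _ h).trans ih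

theorem mem_linkVerts_singleton {v w : W} : w ∈ linkVerts H {v} ↔ H.Adj v w := by
  simp only [linkVerts, Set.mem_singleton_iff, forall_eq, Set.mem_ofPred_eq]

variable [DecidableEq W]

theorem eq_of_triangles_at_vertex {β : Type*} {F : Finset W → β} {w x y x' y' : W}
    (hlink : (link H {w}).Preconnected)
    (hF : ∀ x y z, H.Adj w x → H.Adj w y → H.Adj x y → H.Adj w z → H.Adj x z →
      F {w, x, y} = F {w, x, z})
    (hwx : H.Adj w x) (hwy : H.Adj w y) (hxy : H.Adj x y)
    (hwx' : H.Adj w x') (hwy' : H.Adj w y') (hxy' : H.Adj x' y') :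
    F {w, x, y} = F {w, x', y'} := by
  suffices h : ∀ a b : linkVerts H {w}, (link H {w}).Walk a b → ∀ y, H.Adj w y → H.Adj a y →
      ∀ y', H.Adj w y' → H.Adj b y' → F {w, ↑a, y} = F {w, ↑b, y'} by
    obtain ⟨p⟩ := hlink ⟨x, mem_linkVerts_singleton.2 hwx⟩ ⟨x', mem_linkVerts_singleton.2 hwx'⟩
    exact h _ _ p y hwy hxy y' hwy' hxy'
  intro a b p
  induction p with
  | @nil a =>
    intro y hwy hay y' hwy' hay'
    exact hF a y y' (mem_linkVerts_singleton.1 a.2) hwy hay hwy' hay'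
  | @cons a c b hac _ ih =>
    intro y hwy hay y' hwy' hby'
    have hwa := mem_linkVerts_singleton.1 a.2
    have hwc := mem_linkVerts_singleton.1 c.2
    rw [hF a y c hwa hwy hay hwc hac, pair_comm (a : W) c]
    exact ih a hwa hac.symm y' hwy' hby'

theorem eq_of_triangles {β : Type*} {F : Finset W → β} (hconn : H.Preconnected)
    (hlink : ∀ w, (link H {w}).Preconnected)
    (hedge : ∀ u v, H.Adj u v → ∃ w, H.Adj u w ∧ H.Adj v w)
    (hF : ∀ w x y z, H.Adj w x → H.Adj w y → H.Adj x y → H.Adj w z → H.Adj x z →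
      F {w, x, y} = F {w, x, z})
    {s t : Finset W} (hs : H.IsNClique 3 s) (ht : H.IsNClique 3 t) : F s = F t := by
  obtain ⟨w, x, y, hwx, hwy, hxy, rfl⟩ := SimpleGraph.is3Clique_iff.1 hs
  obtain ⟨w', x', y', hwx', hwy', hxy', rfl⟩ := SimpleGraph.is3Clique_iff.1 ht
  obtain ⟨p⟩ := hconn w w'
  clear hs ht
  induction p generalizing x y with
  | nil => exact eq_of_triangles_at_vertex (hlink _) (hF _) hwx hwy hxy hwx' hwy' hxy'
  | @cons w v _ hwv _ ih =>
    obtain ⟨z, hwz, hvz⟩ := hedge w v hwv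
    rw [eq_of_triangles_at_vertex (hlink w) (hF w) hwx hwy hxy hwv hwz hvz, insert_comm]
    exact ih w z hwv.symm hvz hwz hwx' hwy'

variable (H) [Fintype W] [DecidableRel H.Adj]

/-- The boundary map from edges to vertices modulo two. -/
def edgeVertexMatrix : Matrix H.edgeFinset W (ZMod 2) :=
  fun e w => if w ∈ e.1 then 1 else 0

/-- The boundary map from triangles to edges modulo two. -/
def triangleEdgeMatrix : Matrix (H.cliqueFinset 3) H.edgeFinset (ZMod 2) :=
  fun t e => if e.1.toFinset ⊆ t.1 then 1 else 0

variable {H}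

theorem card_edges_at_vertex_of_triangle {t : Finset W} (ht : H.IsNClique 3 t) (w : W) :
    #{e ∈ H.edgeFinset | w ∈ e ∧ e.toFinset ⊆ t} = if w ∈ t then 2 else 0 := by
  split_ifs with hw
  · have : {e ∈ H.edgeFinset | w ∈ e ∧ e.toFinset ⊆ t} = (t.erase w).image (s(w, ·)) := by
      ext e
      simp only [mem_filter, mem_image, mem_erase]
      constructor
      · rintro ⟨he, hwe, het⟩
        obtain ⟨x, rfl⟩ := Sym2.mem_iff_exists.1 hwe
        rw [SimpleGraph.mem_edgeFinset, SimpleGraph.mem_edgeSet] at he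
        exact ⟨x, ⟨he.ne', het (by simp)⟩, rfl⟩
      · rintro ⟨x, ⟨hxw, hx⟩, rfl⟩
        rw [SimpleGraph.mem_edgeFinset, SimpleGraph.mem_edgeSet, Sym2.toFinset_mk_eq]
        exact ⟨ht.isClique hw hx hxw.symm, Sym2.mem_mk_left w x,
          insert_subset hw (singleton_subset_iff.2 hx)⟩
    rw [this, card_image_of_injective _ fun x y => Sym2.congr_right.1, card_erase_of_mem hw,
      ht.card_eq]
  · rw [card_eq_zero, filter_eq_empty_iff]
    rintro e - ⟨hwe, het⟩
    exact hw (het (Sym2.mem_toFinset.2 hwe))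

theorem triangleEdgeMatrix_mul_edgeVertexMatrix :
    triangleEdgeMatrix H * edgeVertexMatrix H = 0 := by
  ext t w
  have h_even : (#{e ∈ H.edgeFinset | w ∈ e ∧ e.toFinset ⊆ t.1} : ZMod 2) = 0 := by
    rw [card_edges_at_vertex_of_triangle ((SimpleGraph.mem_cliqueFinset_iff ..).1 t.2) w]
    split_ifs <;> rfl
  rw [card_filter, ← sum_coe_sort, Nat.cast_sum] at h_even
  rw [Matrix.mul_apply, Matrix.zero_apply, ← h_even]
  refine sum_congr rfl fun e _ => ?_
  by_cases hw : w ∈ e.1 <;> by_cases he : e.1.toFinset ⊆ t.1 <;>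
    simp [triangleEdgeMatrix, edgeVertexMatrix, hw, he]

theorem edgeVertexMatrix_mulVec (f : W → ZMod 2) {u v : W} (h : s(u, v) ∈ H.edgeFinset) :
    (edgeVertexMatrix H).mulVec f ⟨s(u, v), h⟩ = f u + f v := by
  have h_ends : ({w | w = u ∨ w = v} : Finset W) = {u, v} := by ext; simp
  have huv : H.Adj u v := by simpa using h
  simp only [Matrix.mulVec, dotProduct, edgeVertexMatrix, ite_mul, one_mul, zero_mul, Sym2.mem_iff]
  rw [← sum_filter, h_ends, sum_pair huv.ne]

theorem transpose_triangleEdgeMatrix_mulVec (F : Finset W → ZMod 2) {u v : W}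
    (h : s(u, v) ∈ H.edgeFinset) :
    (triangleEdgeMatrix H).transpose.mulVec (fun t => F t) ⟨s(u, v), h⟩ =
      ∑ w ∈ edgeLink H u v, F {u, v, w} := by
  have huv : H.Adj u v := by simpa using h
  rw [← sum_image (g := fun w => ({u, v, w} : Finset W)) (injOn_triangle u v),
    ← triangles_containing_pair huv, sum_filter, ← sum_coe_sort]
  refine sum_congr rfl fun t _ => ?_
  simp only [Matrix.transpose_apply, triangleEdgeMatrix, ite_mul, one_mul, zero_mul,
    Sym2.toFinset_mk_eq, insert_subset_iff, singleton_subset_iff]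

theorem three_mul_card_triangles (hedge : ∀ u v, H.Adj u v → #(edgeLink H u v) = 2) :
    3 * #(H.cliqueFinset 3) = 2 * #H.edgeFinset := by
  have h := sum_card_interedges_neighborFinset (G := H)
  have h_deg : ∀ v, #(H.interedges (H.neighborFinset v) (H.neighborFinset v)) =
      H.degree v * 2 := by
    intro v
    rw [card_interedges_eq_sum_degIn, ← SimpleGraph.card_neighborFinset_eq_degree]
    refine sum_const_nat fun w hw => ?_
    rw [degIn_neighborFinset, edgeLink_comm, hedge v w ((SimpleGraph.mem_neighborFinset ..).1 hw)]
  rw [sum_congr rfl fun v _ => h_deg v, ← sum_mul, H.sum_degrees_eq_twice_card_edges] at h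
  lia

theorem card_le_rank_edgeVertexMatrix (hconn : H.Preconnected) :
    Fintype.card W ≤ (edgeVertexMatrix H).rank + 1 := by
  refine card_le_rank_add_one _ fun f hf => eq_of_preconnected hconn fun u v huv => ?_
  have huv' : s(u, v) ∈ H.edgeFinset := by simpa using huv
  exact CharTwo.add_eq_zero.1 ((edgeVertexMatrix_mulVec f huv').symm.trans (congrFun hf _))

theorem card_triangles_le_rank_triangleEdgeMatrix (hconn : H.Preconnected)
    (hedge : ∀ u v, H.Adj u v → #(edgeLink H u v) = 2)
    (hlink : ∀ v, (link H {v}).Preconnected) :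
    #(H.cliqueFinset 3) ≤ (triangleEdgeMatrix H).rank + 1 := by
  rw [← Matrix.rank_transpose, ← Fintype.card_coe]
  refine card_le_rank_add_one _ fun f hf => ?_
  obtain ⟨F, rfl⟩ : ∃ F : Finset W → ZMod 2, f = fun t => F t.1 :=
    ⟨Function.extend Subtype.val f 0, funext fun t => (Subtype.val_injective.extend_apply ..).symm⟩
  have hF : ∀ w x y z, H.Adj w x → H.Adj w y → H.Adj x y → H.Adj w z → H.Adj x z →
      F {w, x, y} = F {w, x, z} := by
    intro w x y z hwx hwy hxy hwz hxz
    rcases eq_or_ne y z with rfl | hyz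
    · rfl
    have h_link : {y, z} = edgeLink H w x :=
      eq_of_subset_of_card_le (insert_subset (mem_edgeLink.2 ⟨hwy, hxy⟩)
        (singleton_subset_iff.2 (mem_edgeLink.2 ⟨hwz, hxz⟩)))
        (by rw [hedge w x hwx, card_pair hyz])
    have hwx' : s(w, x) ∈ H.edgeFinset := by simpa using hwx
    have h := (transpose_triangleEdgeMatrix_mulVec F hwx').symm.trans (congrFun hf _)
    rw [← h_link, sum_pair hyz] at h
    exact CharTwo.add_eq_zero.1 h
  have h_third : ∀ u v, H.Adj u v → ∃ w, H.Adj u w ∧ H.Adj v w := by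
    intro u v huv
    obtain ⟨w, hw⟩ := card_pos.1 (by rw [hedge u v huv]; norm_num : 0 < #(edgeLink H u v))
    exact ⟨w, mem_edgeLink.1 hw⟩
  exact fun s t => eq_of_triangles hconn hlink h_third hF
    ((SimpleGraph.mem_cliqueFinset_iff ..).1 s.2) ((SimpleGraph.mem_cliqueFinset_iff ..).1 t.2)

/-- The Euler characteristic of a connected closed surface is at most two: modulo two, the first
homology group of the chain complex of the triangulation has non-negative dimension. -/
theorem three_mul_card_le_card_edges_add_six (hconn : H.Preconnected)
    (hedge : ∀ u v, H.Adj u v → #(edgeLink H u v) = 2)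
    (hlink : ∀ v, (link H {v}).Preconnected) :
    3 * Fintype.card W ≤ #H.edgeFinset + 6 := by
  have h_mul := Matrix.rank_add_rank_le_card_of_mul_eq_zero
    (triangleEdgeMatrix_mul_edgeVertexMatrix (H := H))
  have h_vert := card_le_rank_edgeVertexMatrix hconn
  have h_tri := card_triangles_le_rank_triangleEdgeMatrix hconn hedge hlink
  have h_three := three_mul_card_triangles hedge
  rw [Fintype.card_coe] at h_mul
  lia

end Surfaces

/-! ### Flag 3-manifolds -/

section Manifold

variable {V : Type*}

theorem mem_linkVerts_pair {G : SimpleGraph V} {u v w : V} :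
    w ∈ linkVerts G {u, v} ↔ G.Adj u w ∧ G.Adj v w := by
  simp [linkVerts]

/-- The link of a vertex in a link is the link of the enlarged clique. -/
def linkLinkIso (G : SimpleGraph V) (σ : Set V) (w : linkVerts G σ) :
    link (link G σ) {w} ≃g link G (insert ↑w σ) where
  toFun x := ⟨x, by
    rintro v (rfl | hv)
    exacts [(mem_linkVerts_singleton (H := link G σ)).1 x.2, x.1.2 v hv]⟩
  invFun x := ⟨⟨x, fun v hv => x.2 v (Set.mem_insert_of_mem _ hv)⟩,
    mem_linkVerts_singleton.2 (x.2 w (Set.mem_insert _ _))⟩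
  left_inv _ := rfl
  right_inv _ := rfl
  map_rel_iff' := Iff.rfl

variable [Fintype V] [DecidableEq V] {G : SimpleGraph V} [DecidableRel G.Adj]

theorem linkVerts_pair (u v : V) : linkVerts G {u, v} = edgeLink G u v := by
  ext w
  rw [mem_linkVerts_pair, mem_coe, mem_edgeLink]

theorem map_neighborFinset_link {σ : Set V} [DecidablePred (· ∈ linkVerts G σ)]
    [DecidableRel (link G σ).Adj] (w : linkVerts G σ) :
    ((link G σ).neighborFinset w).map (.subtype _) =
      G.neighborFinset w ∩ (linkVerts G σ).toFinset := by
  convert G.map_neighborFinset_induce w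
  rfl

theorem card_edgeLink_link {σ : Set V} [DecidablePred (· ∈ linkVerts G σ)]
    [DecidableRel (link G σ).Adj] (w x : linkVerts G σ) :
    #(edgeLink (link G σ) w x) = #(edgeLink G w x ∩ (linkVerts G σ).toFinset) := by
  rw [← card_map (.subtype (· ∈ linkVerts G σ)), map_inter, map_neighborFinset_link,
    map_neighborFinset_link, ← inter_inter_distrib_right]

omit [DecidableEq V] in
theorem two_mul_card_edges_link {σ : Set V} [DecidablePred (· ∈ linkVerts G σ)]
    [DecidableRel (link G σ).Adj] :
    2 * #(link G σ).edgeFinset =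
      #(G.interedges (linkVerts G σ).toFinset (linkVerts G σ).toFinset) := by
  classical
  rw [← SimpleGraph.sum_degrees_eq_twice_card_edges, card_interedges_eq_sum_degIn,
    sum_subtype (p := (· ∈ linkVerts G σ)) _ fun x => Set.mem_toFinset]
  refine sum_congr rfl fun w _ => ?_
  rw [degIn_eq_card_inter, ← SimpleGraph.card_neighborFinset_eq_degree,
    ← map_neighborFinset_link, card_map]

/-- The graph `G` is the one-skeleton of a flag triangulation of a closed 3-manifold with the
minimal number of triangles: given that the vertex links are connected closed surfaces, the
triangle count says that all of them are spheres. -/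
structure IsFlag3Manifold (G : SimpleGraph V) [DecidableRel G.Adj] : Prop where
  card_triangles : (#(G.cliqueFinset 3) : ℤ) = 2 * ((#G.edgeFinset : ℤ) - (Fintype.card V : ℤ))
  edge_link : ∀ u v : V, G.Adj u v → IsCycleOfLengthAtLeast (link G {u, v}) 4
  triangle_link : ∀ t : Finset V, G.IsNClique 3 t →
    (linkVerts G (t : Set V)).ncard = 2 ∧ link G (t : Set V) = ⊥
  vertex_link_connected : ∀ v : V, (link G {v}).Connected

theorem IsFascinating.isFlag3Manifold (hG : IsFascinating G) : IsFlag3Manifold G :=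
  ⟨hG.card_triangles, hG.edge_link, hG.triangle_link, hG.vertex_link_connected⟩

namespace IsFlag3Manifold

theorem preconnected_edge_link (hG : IsFlag3Manifold G) {u v : V} (huv : G.Adj u v) :
    (link G {u, v}).Preconnected := by
  obtain ⟨l, -, -, ⟨φ⟩⟩ := hG.edge_link u v huv
  exact φ.preconnected_iff.2 SimpleGraph.cycleGraph_preconnected

theorem four_le_card_edgeLink (hG : IsFlag3Manifold G) {u v : V} (huv : G.Adj u v) :
    4 ≤ #(edgeLink G u v) := by
  obtain ⟨l, -, hl, ⟨φ⟩⟩ := hG.edge_link u v huv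
  have h_card : Nat.card (linkVerts G {u, v}) = l := by
    rw [Nat.card_congr φ.toEquiv, Nat.card_fin]
  rwa [← h_card, Nat.card_coe_set_eq, linkVerts_pair, Set.ncard_coe_finset] at hl

theorem eq_edgeLink_of_closed (hG : IsFlag3Manifold G) {u v : V} (huv : G.Adj u v)
    {S : Finset V} (hS : S ⊆ edgeLink G u v) (hne : S.Nonempty)
    (hcl : ∀ x ∈ S, ∀ y ∈ edgeLink G u v, G.Adj x y → y ∈ S) : S = edgeLink G u v := by
  refine hS.antisymm fun y hy => ?_
  obtain ⟨x, hx⟩ := hne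
  have hmem : ∀ {z}, z ∈ edgeLink G u v → z ∈ linkVerts G {u, v} := fun hz =>
    mem_linkVerts_pair.2 (mem_edgeLink.1 hz)
  have hmem' : ∀ z : linkVerts G {u, v}, ↑z ∈ edgeLink G u v := fun z =>
    mem_edgeLink.2 (mem_linkVerts_pair.1 z.2)
  have h := eq_of_preconnected (f := fun z : linkVerts G {u, v} => (z : V) ∈ S)
    (hG.preconnected_edge_link huv)
    (fun a b hab => propext ⟨fun ha => hcl a ha b (hmem' b) hab,
      fun hb => hcl b hb a (hmem' a) hab.symm⟩) ⟨x, hmem (hS hx)⟩ ⟨y, hmem hy⟩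
  exact h.mp hx

theorem card_edgeLink_inter_neighborFinset (hG : IsFlag3Manifold G) {u v w : V}
    (huv : G.Adj u v) (huw : G.Adj u w) (hvw : G.Adj v w) :
    #(edgeLink G u v ∩ G.neighborFinset w) = 2 := by
  rw [← (hG.triangle_link {u, v, w} (SimpleGraph.is3Clique_triple_iff.2 ⟨huv, huw, hvw⟩)).1,
    ← Set.ncard_coe_finset]
  congr 1
  ext x
  simp [linkVerts]

theorem cliqueFreeOn_edgeLink (hG : IsFlag3Manifold G) {u v : V} (huv : G.Adj u v) :
    G.CliqueFreeOn (edgeLink G u v) 3 := by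
  intro t ht h_clique
  obtain ⟨x, y, z, hxy, hxz, hyz, rfl⟩ := SimpleGraph.is3Clique_iff.1 h_clique
  obtain ⟨hux, hvx⟩ := mem_edgeLink.1 (mem_coe.1 (ht (by simp : x ∈ _)))
  obtain ⟨huy, hvy⟩ := mem_edgeLink.1 (mem_coe.1 (ht (by simp : y ∈ _)))
  obtain ⟨huz, hvz⟩ := mem_edgeLink.1 (mem_coe.1 (ht (by simp : z ∈ _)))
  have h_bot := (hG.triangle_link {u, v, x} (SimpleGraph.is3Clique_triple_iff.2 ⟨huv, hux, hvx⟩)).2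
  have hy : y ∈ linkVerts G (({u, v, x} : Finset V) : Set V) := by simp [linkVerts, huy, hvy, hxy]
  have hz : z ∈ linkVerts G (({u, v, x} : Finset V) : Set V) := by simp [linkVerts, huz, hvz, hxz]
  have h_adj : (link G (({u, v, x} : Finset V) : Set V)).Adj ⟨y, hy⟩ ⟨z, hz⟩ := hyz
  rwa [h_bot] at h_adj

theorem six_mul_degree_le (hG : IsFlag3Manifold G) (v : V) :
    6 * G.degree v ≤ #(G.interedges (G.neighborFinset v) (G.neighborFinset v)) + 12 := by
  classical
  have h_verts : (linkVerts G {v}).toFinset = G.neighborFinset v := by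
    ext w
    rw [Set.mem_toFinset, mem_linkVerts_singleton, SimpleGraph.mem_neighborFinset]
  have h_edge : ∀ w x, (link G {v}).Adj w x → #(edgeLink (link G {v}) w x) = 2 := by
    intro w x hwx
    rw [card_edgeLink_link, h_verts]
    exact hG.card_edgeLink_inter_neighborFinset hwx (mem_linkVerts_singleton.1 w.2).symm
      (mem_linkVerts_singleton.1 x.2).symm
  have h_link : ∀ w, (link (link G {v}) {w}).Preconnected := by
    intro w
    rw [(linkLinkIso G {v} w).preconnected_iff]
    exact hG.preconnected_edge_link (mem_linkVerts_singleton.1 w.2).symm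
  have h :=
    three_mul_card_le_card_edges_add_six (hG.vertex_link_connected v).preconnected h_edge h_link
  have h_edges := two_mul_card_edges_link (G := G) (σ := {v})
  have h_card : Fintype.card (linkVerts G {v}) = G.degree v := by
    rw [← Set.toFinset_card, h_verts, SimpleGraph.card_neighborFinset_eq_degree]
  rw [h_verts] at h_edges
  rw [← h_edges, ← h_card]
  lia

theorem card_interedges_neighborFinset_add_twelve (hG : IsFlag3Manifold G) (v : V) :
    #(G.interedges (G.neighborFinset v) (G.neighborFinset v)) + 12 = 6 * G.degree v := by
  have h_sum : ∑ v, 6 * G.degree v =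
      ∑ v, (#(G.interedges (G.neighborFinset v) (G.neighborFinset v)) + 12) := by
    have h := hG.card_triangles
    rw [sum_add_distrib, sum_card_interedges_neighborFinset, ← mul_sum,
      G.sum_degrees_eq_twice_card_edges, sum_const, smul_eq_mul, card_univ]
    lia
  exact ((sum_eq_sum_iff_of_le fun v _ => hG.six_mul_degree_le v).1 h_sum v
    (mem_univ v)).symm

theorem six_le_degree (hG : IsFlag3Manifold G) (v : V) : 6 ≤ G.degree v := by
  have h := hG.card_interedges_neighborFinset_add_twelve v
  have h_four : G.degree v * 4 ≤ #(G.interedges (G.neighborFinset v) (G.neighborFinset v)) := by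
    rw [card_interedges_eq_sum_degIn, ← SimpleGraph.card_neighborFinset_eq_degree, ← smul_eq_mul]
    refine card_nsmul_le_sum _ _ 4 fun w hw => ?_
    rw [degIn_neighborFinset]
    exact hG.four_le_card_edgeLink ((SimpleGraph.mem_neighborFinset ..).1 hw).symm
  lia

end IsFlag3Manifold

end Manifold

/-! ### Two-coloured vertex links -/

section TwoColouredLinks

variable {V : Type*} {G : SimpleGraph V} [DecidableRel G.Adj]

theorem card_interedges_of_isNClique_three {t : Finset V} (ht : G.IsNClique 3 t) :
    #(G.interedges t t) = 6 := by
  have h : G.interedges t t = t.offDiag := by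
    ext ⟨x, y⟩
    simp only [SimpleGraph.mem_interedges_iff, mem_offDiag]
    exact ⟨fun h => ⟨h.1, h.2.1, h.2.2.ne⟩, fun h => ⟨h.1, h.2.1, ht.isClique h.1 h.2.1 h.2.2⟩⟩
  rw [h, offDiag_card, ht.card_eq]

variable [DecidableEq V]

theorem card_interedges_inter_of_isClique {t P Q : Finset V} (ht : G.IsClique t)
    (hd : Disjoint P Q) : #(G.interedges (t ∩ P) (t ∩ Q)) = #(t ∩ P) * #(t ∩ Q) := by
  have h : G.interedges (t ∩ P) (t ∩ Q) = (t ∩ P) ×ˢ (t ∩ Q) := by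
    ext ⟨x, y⟩
    simp only [SimpleGraph.mem_interedges_iff, mem_product, ← and_assoc, and_iff_left_iff_imp]
    intro ⟨hx, hy⟩
    exact ht (mem_inter.1 hx).1 (mem_inter.1 hy).1
      (disjoint_iff_ne.1 hd x (mem_inter.1 hx).2 y (mem_inter.1 hy).2)
  rw [h, card_product]

variable [Fintype V]

/-- The triangles of the link of the vertex `v`. -/
def linkTriangles (G : SimpleGraph V) [DecidableRel G.Adj] (v : V) : Finset (Finset V) :=
  {t ∈ G.cliqueFinset 3 | t ⊆ G.neighborFinset v}

theorem mem_linkTriangles {v : V} {t : Finset V} :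
    t ∈ linkTriangles G v ↔ G.IsNClique 3 t ∧ t ⊆ G.neighborFinset v := by
  rw [linkTriangles, mem_filter, SimpleGraph.mem_cliqueFinset_iff]

namespace IsFlag3Manifold

theorem card_linkTriangles_containing_pair (hG : IsFlag3Manifold G) {v x y : V}
    (hx : G.Adj v x) (hy : G.Adj v y) (hxy : G.Adj x y) :
    #{t ∈ linkTriangles G v | x ∈ t ∧ y ∈ t} = 2 := by
  have h : {t ∈ linkTriangles G v | x ∈ t ∧ y ∈ t} =
      (edgeLink G x y ∩ G.neighborFinset v).image fun z => {x, y, z} := by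
    rw [linkTriangles, filter_comm, triangles_containing_pair hxy, filter_image,
      ← filter_mem_eq_inter]
    simp [insert_subset_iff, hx, hy]
  rw [h, card_image_of_injOn ((injOn_triangle (G := G) x y).mono (coe_subset.2 inter_subset_left)),
    hG.card_edgeLink_inter_neighborFinset hxy hx.symm hy.symm]

theorem two_mul_card_interedges (hG : IsFlag3Manifold G) {v : V} {S T : Finset V}
    (hS : S ⊆ G.neighborFinset v) (hT : T ⊆ G.neighborFinset v) :
    2 * #(G.interedges S T) = ∑ t ∈ linkTriangles G v, #(G.interedges (t ∩ S) (t ∩ T)) := by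
  have h := sum_card_bipartiteAbove_eq_sum_card_bipartiteBelow
    (s := G.interedges S T) (t := linkTriangles G v) fun p t => p.1 ∈ t ∧ p.2 ∈ t
  simp only [bipartiteAbove, bipartiteBelow] at h
  rw [sum_const_nat (m := 2), mul_comm] at h
  · refine h.trans (sum_congr rfl fun t _ => congrArg card ?_)
    ext ⟨x, y⟩
    simp only [mem_filter, SimpleGraph.mem_interedges_iff, mem_inter]
    tauto
  · rintro ⟨x, y⟩ hxy
    obtain ⟨hx, hy, hadj⟩ := G.mem_interedges_iff.1 hxy
    exact hG.card_linkTriangles_containing_pair ((SimpleGraph.mem_neighborFinset ..).1 (hS hx))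
      ((SimpleGraph.mem_neighborFinset ..).1 (hT hy)) hadj

theorem card_linkTriangles (hG : IsFlag3Manifold G) (v : V) :
    #(linkTriangles G v) + 4 = 2 * G.degree v := by
  have h := hG.two_mul_card_interedges (subset_refl (G.neighborFinset v)) subset_rfl
  rw [sum_const_nat (m := 6)] at h
  · have := hG.card_interedges_neighborFinset_add_twelve v
    lia
  · intro t ht
    rw [mem_linkTriangles] at ht
    rw [inter_eq_left.2 ht.2, card_interedges_of_isNClique_three ht.1]

/-- Every edge between the two colours lies in two triangles, and every triangle meeting both
colours has two such edges; so there are as many of these edges as of these triangles. -/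
theorem card_interedges_eq_card_mixed (hG : IsFlag3Manifold G) {v : V} {P Q : Finset V}
    (hd : Disjoint P Q) (hN : P ∪ Q = G.neighborFinset v) :
    #(G.interedges P Q) = #{t ∈ linkTriangles G v | ¬ t ⊆ P ∧ ¬ t ⊆ Q} := by
  have h := hG.two_mul_card_interedges (hN ▸ subset_union_left : P ⊆ _)
    (hN ▸ subset_union_right : Q ⊆ _)
  suffices h_tri : ∀ t ∈ linkTriangles G v, #(G.interedges (t ∩ P) (t ∩ Q)) =
      if ¬ t ⊆ P ∧ ¬ t ⊆ Q then 2 else 0 by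
    rw [sum_congr rfl h_tri, ← sum_filter, sum_const, smul_eq_mul] at h
    lia
  intro t ht
  obtain ⟨h_clique, htN⟩ := mem_linkTriangles.1 ht
  rw [card_interedges_inter_of_isClique h_clique.isClique hd]
  have h_card : #(t ∩ P) + #(t ∩ Q) = 3 := by
    rw [← card_union_of_disjoint (hd.mono inter_subset_right inter_subset_right),
      ← inter_union_distrib_left, hN, inter_eq_left.2 htN, h_clique.card_eq]
  have h_sub : ∀ S, t ⊆ S ↔ #(t ∩ S) = 3 := by
    intro S
    rw [← inter_eq_left, ← h_clique.card_eq]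
    exact ⟨fun h => by rw [h], fun h => eq_of_subset_of_card_le inter_subset_left h.ge⟩
  simp only [h_sub]
  generalize #(t ∩ P) = p at *
  generalize #(t ∩ Q) = q at *
  obtain rfl : q = 3 - p := by lia
  have : p ≤ 3 := by lia
  interval_cases p <;> rfl

theorem card_interedges_add_four_le (hG : IsFlag3Manifold G) {v : V} {P Q : Finset V}
    (hd : Disjoint P Q) (hN : P ∪ Q = G.neighborFinset v) :
    #(G.interedges P Q) + 4 ≤ 2 * G.degree v := by
  rw [hG.card_interedges_eq_card_mixed hd hN, ← hG.card_linkTriangles v]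
  exact Nat.add_le_add_right (card_filter_le _ _) 4

theorem card_interedges_add_four_eq (hG : IsFlag3Manifold G) {v : V} {P Q : Finset V}
    (hd : Disjoint P Q) (hN : P ∪ Q = G.neighborFinset v) (hP : G.CliqueFreeOn P 3)
    (hQ : G.CliqueFreeOn Q 3) : #(G.interedges P Q) + 4 = 2 * G.degree v := by
  rw [hG.card_interedges_eq_card_mixed hd hN, ← hG.card_linkTriangles v, filter_true_of_mem]
  intro t ht
  have ht := (mem_linkTriangles.1 ht).1
  exact ⟨fun h => hP (coe_subset.2 h) ht, fun h => hQ (coe_subset.2 h) ht⟩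

theorem card_interedges_colours (hG : IsFlag3Manifold G) {v : V} {P Q : Finset V}
    (hd : Disjoint P Q) (hN : P ∪ Q = G.neighborFinset v) :
    #(G.interedges P P) + #(G.interedges Q Q) + 2 * #(G.interedges P Q) + 12 =
      6 * G.degree v := by
  rw [← hG.card_interedges_neighborFinset_add_twelve v, ← hN, card_interedges_union_left hd,
    card_interedges_union_right hd, card_interedges_union_right hd, card_interedges_comm Q P]
  lia

theorem two_mul_degree_le (hG : IsFlag3Manifold G) {v : V} {P Q : Finset V}
    (hd : Disjoint P Q) (hN : P ∪ Q = G.neighborFinset v) :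
    2 * G.degree v ≤ #(G.interedges P P) + #(G.interedges Q Q) + 4 := by
  have h_cross := hG.card_interedges_add_four_le hd hN
  have h_total := hG.card_interedges_colours hd hN
  lia

theorem degIn_edgeLink (hG : IsFlag3Manifold G) {u v x : V} (huv : G.Adj u v)
    (hx : x ∈ edgeLink G u v) : degIn G x (edgeLink G u v) = 2 := by
  obtain ⟨hux, hvx⟩ := mem_edgeLink.1 hx
  rw [degIn_eq_card_inter, inter_comm, hG.card_edgeLink_inter_neighborFinset huv hux hvx]

theorem eq_edgeLink_of_two_mul_card_le (hG : IsFlag3Manifold G) {u v : V} (huv : G.Adj u v)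
    {S : Finset V} (hS : S ⊆ edgeLink G u v) (hne : S.Nonempty)
    (h : 2 * #S ≤ #(G.interedges S S)) : S = edgeLink G u v := by
  have h_le : ∀ x ∈ S, degIn G x S ≤ 2 := fun x hx =>
    (degIn_mono hS x).trans (hG.degIn_edgeLink huv (hS hx)).le
  have h_eq : ∀ x ∈ S, degIn G x S = 2 := by
    refine (sum_eq_sum_iff_of_le h_le).1 (le_antisymm (sum_le_sum h_le) ?_)
    rwa [sum_const, smul_eq_mul, mul_comm, ← card_interedges_eq_sum_degIn]
  refine hG.eq_edgeLink_of_closed huv hS hne fun x hx y hy hxy => ?_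
  have h_nbrs : {z ∈ S | G.Adj x z} = {z ∈ edgeLink G u v | G.Adj x z} :=
    eq_of_subset_of_card_le (filter_subset_filter _ hS)
      ((hG.degIn_edgeLink huv (hS hx)).le.trans (h_eq x hx).ge)
  exact (mem_filter.1 (h_nbrs ▸ mem_filter.2 ⟨hy, hxy⟩)).1

end IsFlag3Manifold

end TwoColouredLinks

/-! ### Graphs covered by two edge links -/

section Covers

variable {V : Type*}

/-- A graph is the join of its induced subgraphs on two complementary sets with all edges between
them. -/
noncomputable def joinInduceIso {G : SimpleGraph V} {s t : Set V} (h : IsCompl s t)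
    (hadj : ∀ x ∈ s, ∀ y ∈ t, G.Adj x y) : join (G.induce s) (G.induce t) ≃g G where
  toEquiv := by
    classical
    exact (Equiv.sumCongr (.refl s) (Equiv.setCongr h.compl_eq.symm)).trans (Equiv.Set.sumCompl s)
  map_rel_iff' := by
    rintro (x | x) (y | y)
    · simp [join]
    · simp [join, hadj x x.2 y y.2]
    · simp [join, (hadj y y.2 x x.2).symm]
    · simp [join]

/-- Joins of isomorphic graphs are isomorphic. -/
def joinCongr {V' W W' : Type*} {G : SimpleGraph V} {G' : SimpleGraph V'} {H : SimpleGraph W}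
    {H' : SimpleGraph W'} (e : G ≃g G') (f : H ≃g H') : join G H ≃g join G' H' where
  toEquiv := Equiv.sumCongr e.toEquiv f.toEquiv
  map_rel_iff' := by
    rintro (x | x) (y | y)
    · simpa [join] using e.map_adj_iff
    · simp [join]
    · simp [join]
    · simpa [join] using f.map_adj_iff

variable [Fintype V] [DecidableEq V] {G : SimpleGraph V} [DecidableRel G.Adj]

theorem two_mul_card_edgeFinset_le {A B : Finset V} (h : Disjoint A B) :
    2 * #G.edgeFinset ≤ #(G.interedges A A) + #(G.interedges B B) + 2 * #(G.interedges A B) +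
      2 * ∑ x ∈ (A ∪ B)ᶜ, G.degree x := by
  have h_rest : #(G.interedges (A ∪ B)ᶜ univ) = ∑ x ∈ (A ∪ B)ᶜ, G.degree x := by
    simp only [card_interedges_eq_sum_degIn, degIn_univ]
  have h_inner : #(G.interedges (A ∪ B)ᶜ (A ∪ B)) ≤ #(G.interedges (A ∪ B)ᶜ univ) :=
    card_le_card (G.interedges_mono subset_rfl (subset_univ _))
  have h_total := card_interedges_univ (G := G)
  rw [← union_compl (A ∪ B), card_interedges_union_left disjoint_compl_right,
    card_interedges_union_right disjoint_compl_right (A ∪ B), union_compl,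
    card_interedges_comm (A ∪ B) (A ∪ B)ᶜ] at h_total
  rw [card_interedges_union_left h, card_interedges_union_right h, card_interedges_union_right h,
    card_interedges_comm B A] at h_total
  lia

namespace IsFlag3Manifold

theorem card_interedges_edgeLink (hG : IsFlag3Manifold G) {u v : V} (huv : G.Adj u v) :
    #(G.interedges (edgeLink G u v) (edgeLink G u v)) = 2 * #(edgeLink G u v) := by
  rw [card_interedges_eq_sum_degIn, sum_const_nat fun x hx => hG.degIn_edgeLink huv hx, mul_comm]

theorem adj_of_edgeLink_cover (hG : IsFlag3Manifold G) {a a' b b' : V} (ha : G.Adj a a')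
    (hb : G.Adj b b') (hd : Disjoint (edgeLink G b b') (edgeLink G a a'))
    (hc : edgeLink G b b' ∪ edgeLink G a a' = univ) {y z : V} (hz : z ∈ edgeLink G b b')
    (hy : y ∈ edgeLink G a a') : G.Adj z y := by
  have h_deg := hG.two_mul_degree_le
    (hd.mono inter_subset_right inter_subset_right :
      Disjoint (G.neighborFinset y ∩ edgeLink G b b') (G.neighborFinset y ∩ edgeLink G a a'))
    (by rw [← inter_union_distrib_left, hc, inter_univ])
  have h_split : degIn G y (edgeLink G b b') + 2 = G.degree y := by
    rw [← hG.degIn_edgeLink ha hy, ← degIn_union hd, hc, degIn_univ]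
  have h_indep : #(G.interedges (G.neighborFinset y ∩ edgeLink G a a')
      (G.neighborFinset y ∩ edgeLink G a a')) = 0 := by
    rw [card_eq_zero, eq_empty_iff_forall_notMem]
    rintro ⟨w, w'⟩ h
    simp only [SimpleGraph.mem_interedges_iff, mem_inter (s₁ := G.neighborFinset y),
      SimpleGraph.mem_neighborFinset] at h
    obtain ⟨⟨hyw, hw⟩, ⟨hyw', hw'⟩, hww'⟩ := h
    refine hG.cliqueFreeOn_edgeLink ha (t := {y, w, w'}) ?_
      (SimpleGraph.is3Clique_triple_iff.2 ⟨hyw, hyw', hww'⟩)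
    simpa only [coe_subset, insert_subset_iff, singleton_subset_iff] using ⟨hy, hw, hw'⟩
  have h_six := hG.six_le_degree y
  rw [degIn_eq_card_inter] at h_split
  have h_all := hG.eq_edgeLink_of_two_mul_card_le hb inter_subset_right
    (card_pos.1 (by lia)) (by lia : 2 * #(G.neighborFinset y ∩ edgeLink G b b') ≤ _)
  exact ((SimpleGraph.mem_neighborFinset ..).1 (inter_eq_right.1 h_all hz)).symm

theorem isJoinOfTwoCycles_of_cover (hG : IsFlag3Manifold G) {a a' b b' : V} (ha : G.Adj a a')
    (hb : G.Adj b b') (hd : Disjoint (edgeLink G b b') (edgeLink G a a'))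
    (hc : edgeLink G b b' ∪ edgeLink G a a' = univ) : IsJoinOfTwoCycles G := by
  obtain ⟨k, hk, -, ⟨φ⟩⟩ := hG.edge_link b b' hb
  obtain ⟨l, hl, -, ⟨ψ⟩⟩ := hG.edge_link a a' ha
  have h_compl : IsCompl (linkVerts G {b, b'}) (linkVerts G {a, a'}) := by
    rw [linkVerts_pair, linkVerts_pair]
    refine ⟨disjoint_coe.2 hd, codisjoint_iff.2 ?_⟩
    exact (coe_union _ _).symm.trans (hc ▸ coe_univ)
  refine ⟨k, l, hk, hl, ⟨(joinInduceIso h_compl fun z hz y hy => ?_).symm.trans (joinCongr φ ψ)⟩⟩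
  rw [linkVerts_pair, mem_coe] at hz hy
  exact hG.adj_of_edgeLink_cover ha hb hd hc hz hy

theorem interedges_compl_nonempty (hG : IsFlag3Manifold G) {v : V} {P Q : Finset V}
    (hd : Disjoint P Q) (hN : P ∪ Q = G.neighborFinset v) (hP : (G.interedges P P).Nonempty)
    (hQ : (G.interedges Q Q).Nonempty) : (Gᶜ.interedges P Q).Nonempty := by
  obtain ⟨⟨s, s'⟩, h⟩ := hP
  obtain ⟨⟨t, t'⟩, h'⟩ := hQ
  obtain ⟨hs, hs', hss'⟩ := G.mem_interedges_iff.1 h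
  obtain ⟨ht, ht', htt'⟩ := G.mem_interedges_iff.1 h'
  by_contra h_empty
  have h_adj : ∀ x ∈ P, ∀ y ∈ Q, G.Adj x y := by
    intro x hx y hy
    by_contra hxy
    exact h_empty ⟨(x, y), Gᶜ.mem_interedges_iff.2
      ⟨hx, hy, (G.compl_adj x y).2 ⟨disjoint_iff_ne.1 hd x hx y hy, hxy⟩⟩⟩
  have h_nbr : ∀ x ∈ P ∪ Q, G.Adj v x := fun x hx =>
    (SimpleGraph.mem_neighborFinset ..).1 (hN ▸ hx)
  refine hG.cliqueFreeOn_edgeLink (h_nbr s (mem_union_left _ hs)) (t := {s', t, t'}) ?_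
    (SimpleGraph.is3Clique_triple_iff.2 ⟨h_adj s' hs' t ht, h_adj s' hs' t' ht', htt'⟩)
  simp only [coe_subset, insert_subset_iff, singleton_subset_iff, mem_edgeLink]
  exact ⟨⟨h_nbr s' (mem_union_left _ hs'), hss'⟩, ⟨h_nbr t (mem_union_right _ ht), h_adj s hs t ht⟩,
    ⟨h_nbr t' (mem_union_right _ ht'), h_adj s hs t' ht'⟩⟩

theorem three_le_card_colour (hG : IsFlag3Manifold G) {v : V} {P Q : Finset V}
    (hd : Disjoint P Q) (hN : P ∪ Q = G.neighborFinset v) (hP : G.CliqueFreeOn P 3)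
    (hQ : G.CliqueFreeOn Q 3) (hP_lt : P.Nonempty → #(G.interedges P P) < 2 * #P)
    (hQ_lt : Q.Nonempty → #(G.interedges Q Q) < 2 * #Q) : 3 ≤ #P := by
  have h_cross := hG.card_interedges_add_four_eq hd hN hP hQ
  have h_total := hG.card_interedges_colours hd hN
  have h_compl := G.card_interedges_add_card_interedges_compl hd
  have h_six := hG.six_le_degree v
  have h_card : #P + #Q = G.degree v := by
    rw [← card_union_of_disjoint hd, hN, SimpleGraph.card_neighborFinset_eq_degree]
  by_contra! h_lt
  specialize hQ_lt (card_pos.1 (by lia))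
  obtain h | h | h : #P = 0 ∨ #P = 1 ∨ #P = 2 := by lia
  · rw [h] at h_compl
    lia
  · rw [h] at h_compl
    lia
  · rw [h] at h_compl
    specialize hP_lt (card_pos.1 (by lia))
    have h_pos := (hG.interedges_compl_nonempty hd hN (card_pos.1 (by lia))
      (card_pos.1 (by lia))).card_pos
    lia

theorem degree_le_card_compl_add_five (hG : IsFlag3Manifold G) {v : V} {P Q : Finset V}
    (hd : Disjoint P Q) (hN : P ∪ Q = G.neighborFinset v) (hP : G.CliqueFreeOn P 3)
    (hQ : G.CliqueFreeOn Q 3) (hP_lt : P.Nonempty → #(G.interedges P P) < 2 * #P)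
    (hQ_lt : Q.Nonempty → #(G.interedges Q Q) < 2 * #Q) :
    G.degree v ≤ #(Gᶜ.interedges P Q) + 5 := by
  have hP_three := hG.three_le_card_colour hd hN hP hQ hP_lt hQ_lt
  have hQ_three := hG.three_le_card_colour hd.symm (union_comm P Q ▸ hN) hQ hP hQ_lt hP_lt
  have h_cross := hG.card_interedges_add_four_eq hd hN hP hQ
  have h_card : #P + #Q = G.degree v := by
    rw [← card_union_of_disjoint hd, hN, SimpleGraph.card_neighborFinset_eq_degree]
  have h_compl := G.card_interedges_add_card_interedges_compl hd
  obtain ⟨p, hp⟩ := Nat.exists_eq_add_of_le hP_three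
  obtain ⟨q, hq⟩ := Nat.exists_eq_add_of_le hQ_three
  rw [hp, hq] at h_card h_compl
  nlinarith [Nat.zero_le (p * q)]

theorem card_edgeFinset_le_of_extra_vertex (hG : IsFlag3Manifold G) {a a' b b' x : V}
    (ha : G.Adj a a') (hb : G.Adj b b') (hd : Disjoint (edgeLink G b b') (edgeLink G a a'))
    (hc : (edgeLink G b b' ∪ edgeLink G a a')ᶜ = {x})
    (hxb : ¬ edgeLink G b b' ⊆ G.neighborFinset x)
    (hxa : ¬ edgeLink G a a' ⊆ G.neighborFinset x) :
    4 * #G.edgeFinset ≤ Fintype.card V ^ 2 + 2 * Fintype.card V + 17 := by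
  have h_edges := two_mul_card_edgeFinset_le (G := G) hd
  rw [hG.card_interedges_edgeLink ha, hG.card_interedges_edgeLink hb, hc, sum_singleton] at h_edges
  have h_lt : ∀ u v : V, G.Adj u v → ¬ edgeLink G u v ⊆ G.neighborFinset x →
      (G.neighborFinset x ∩ edgeLink G u v).Nonempty →
      #(G.interedges (G.neighborFinset x ∩ edgeLink G u v)
        (G.neighborFinset x ∩ edgeLink G u v)) < 2 * #(G.neighborFinset x ∩ edgeLink G u v) := by
    intro u v huv h_not hne
    by_contra! h
    exact h_not (inter_eq_right.1
      (hG.eq_edgeLink_of_two_mul_card_le huv inter_subset_right hne h))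
  have h_free : ∀ u v : V, G.Adj u v →
      G.CliqueFreeOn ↑(G.neighborFinset x ∩ edgeLink G u v) 3 := fun u v huv =>
    (hG.cliqueFreeOn_edgeLink huv).subset _ (coe_subset.2 inter_subset_right)
  have h_inter : G.neighborFinset x ∩ edgeLink G b b' ∪ G.neighborFinset x ∩ edgeLink G a a' =
      G.neighborFinset x := by
    rw [← inter_union_distrib_left, ← compl_compl (edgeLink G b b' ∪ edgeLink G a a'), hc,
      inter_eq_left]
    exact subset_compl_comm.1 (singleton_subset_iff.2 (by simp))
  have h_deg := hG.degree_le_card_compl_add_five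
    (hd.mono inter_subset_right inter_subset_right) h_inter (h_free b b' hb) (h_free a a' ha)
    (h_lt b b' hb hxb) (h_lt a a' ha hxa)
  have h_mono := card_le_card (Gᶜ.interedges_mono
    (inter_subset_right : G.neighborFinset x ∩ edgeLink G b b' ⊆ _)
    (inter_subset_right : G.neighborFinset x ∩ edgeLink G a a' ⊆ _))
  have h_compl := G.card_interedges_add_card_interedges_compl hd
  have h_n : Fintype.card V = #(edgeLink G b b') + #(edgeLink G a a') + 1 := by
    rw [← card_union_of_disjoint hd, ← card_singleton x, ← hc, card_add_card_compl]
  have h_amgm := four_mul_le_sq_add #(edgeLink G b b') #(edgeLink G a a')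
  rw [h_n]
  nlinarith

theorem isJoinOfTwoCycles_of_card_compl_le_one (hG : IsFlag3Manifold G) {a a' b b' : V}
    (ha : G.Adj a a') (hb : G.Adj b b') (hd : Disjoint (edgeLink G b b') (edgeLink G a a'))
    (hc : #(edgeLink G b b' ∪ edgeLink G a a')ᶜ ≤ 1)
    (hx : ∀ x ∉ edgeLink G b b' ∪ edgeLink G a a',
      ¬ edgeLink G b b' ⊆ G.neighborFinset x ∧ ¬ edgeLink G a a' ⊆ G.neighborFinset x)
    (hm : Fintype.card V ^ 2 + 2 * Fintype.card V + 17 < 4 * #G.edgeFinset) :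
    IsJoinOfTwoCycles G := by
  rcases Nat.le_one_iff_eq_zero_or_eq_one.1 hc with h | h
  · exact hG.isJoinOfTwoCycles_of_cover ha hb hd (compl_eq_empty_iff _ |>.1 (card_eq_zero.1 h))
  · obtain ⟨x, h_eq⟩ := card_eq_one.1 h
    obtain ⟨hxb, hxa⟩ := hx x (mem_compl.1 (h_eq ▸ mem_singleton_self x))
    exact absurd (hG.card_edgeFinset_le_of_extra_vertex ha hb hd h_eq hxb hxa) hm.not_ge

end IsFlag3Manifold

end Covers

/-! ### The approximate structure of dense graphs -/

section DenseSplits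

variable {V : Type*} [Fintype V] {G : SimpleGraph V} [DecidableRel G.Adj]

theorem sum_sum_degree_neighborFinset :
    ∑ u, ∑ v ∈ G.neighborFinset u, G.degree v = ∑ u, G.degree u ^ 2 := by
  rw [sum_comm' (t' := univ) (s' := fun v => G.neighborFinset v)
    (by simp [G.adj_comm])]
  refine sum_congr rfl fun u _ => ?_
  rw [sum_const, SimpleGraph.card_neighborFinset_eq_degree, smul_eq_mul, sq]

/-- The vertices with at least `n / 50` neighbours in `T`. When few edges between `S` and `T = Sᶜ`
are missing, `rich G T` is the corrected version of `S`. -/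
def rich (G : SimpleGraph V) [DecidableRel G.Adj] (T : Finset V) : Finset V :=
  {x | Fintype.card V ≤ 50 * degIn G x T}

theorem mem_rich {T : Finset V} {x : V} :
    x ∈ rich G T ↔ Fintype.card V ≤ 50 * degIn G x T := by
  rw [rich, mem_filter, and_iff_right (mem_univ x)]

theorem disjoint_rich {S T : Finset V}
    (h_mul : ∀ x, degIn G x S * degIn G x T ≤ 11 * Fintype.card V)
    (hn : 10 ^ 5 ≤ Fintype.card V) : Disjoint (rich G T) (rich G S) := by
  rw [disjoint_left]
  intro x hxT hxS
  rw [mem_rich] at hxT hxS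
  nlinarith [Nat.mul_le_mul hxT hxS, h_mul x]

variable [DecidableEq V]

theorem card_interedges_self_le_add (S T : Finset V) :
    #(G.interedges S S) ≤ #(G.interedges T T) + 2 * #(S \ T) * Fintype.card V := by
  have h_sub : G.interedges S S ⊆ G.interedges T T ∪ ((S \ T) ×ˢ univ ∪ univ ×ˢ (S \ T)) := by
    rintro ⟨x, y⟩
    simp only [SimpleGraph.mem_interedges_iff, mem_union, mem_product, mem_sdiff, mem_univ]
    tauto
  have h_card := (card_le_card h_sub).trans ((card_union_le _ _).trans
    (Nat.add_le_add_left (card_union_le _ _) _))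
  rw [card_product, card_product, card_univ] at h_card
  lia

/-- Otherwise `deg u + deg v ≤ n - 4 + codeg u v` for all edges `uv`. Summing this over the edges
bounds `∑ (deg u) ^ 2` from above, which contradicts the Cauchy–Schwarz inequality. -/
theorem IsFlag3Manifold.exists_adj_card_union (hG : IsFlag3Manifold G)
    (hm : Fintype.card V ^ 2 + 2 * Fintype.card V < 4 * #G.edgeFinset) :
    ∃ u v, G.Adj u v ∧ Fintype.card V ≤ #(G.neighborFinset u ∪ G.neighborFinset v) + 3 := by
  by_contra! h_small
  have h_vertex : ∀ u, G.degree u ^ 2 + ∑ v ∈ G.neighborFinset u, G.degree v + 4 * G.degree u +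
      12 ≤ G.degree u * Fintype.card V + 6 * G.degree u := by
    intro u
    have h_edge : ∀ v ∈ G.neighborFinset u,
        G.degree u + G.degree v + 4 ≤ Fintype.card V + degIn G v (G.neighborFinset u) := by
      intro v hv
      have h_union := h_small u v ((SimpleGraph.mem_neighborFinset ..).1 hv)
      have h_card := card_union_add_card_inter (G.neighborFinset u) (G.neighborFinset v)
      rw [degIn_neighborFinset, edgeLink_comm]
      simp only [SimpleGraph.card_neighborFinset_eq_degree] at h_card
      lia
    have h_sum := sum_le_sum h_edge
    simp only [sum_add_distrib, sum_const, smul_eq_mul, ← card_interedges_eq_sum_degIn,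
      SimpleGraph.card_neighborFinset_eq_degree] at h_sum
    have h_link := hG.card_interedges_neighborFinset_add_twelve u
    lia
  have h_sum := sum_le_sum fun u (_ : u ∈ univ) => h_vertex u
  simp only [sum_add_distrib, ← mul_sum, ← sum_mul, sum_sum_degree_neighborFinset,
    G.sum_degrees_eq_twice_card_edges, sum_const, card_univ, smul_eq_mul] at h_sum
  have h_sq := sq_sum_le_card_mul_sum_sq (s := (univ : Finset V)) (f := fun v => G.degree v)
  rw [G.sum_degrees_eq_twice_card_edges, card_univ] at h_sq
  have h_scaled := Nat.mul_le_mul_left (Fintype.card V) h_sum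
  have h_dense := Nat.mul_lt_mul_of_pos_left hm (show 0 < #G.edgeFinset by lia)
  lia

theorem IsFlag3Manifold.exists_sparse_cut (hG : IsFlag3Manifold G)
    (hm : Fintype.card V ^ 2 + 2 * Fintype.card V < 4 * #G.edgeFinset) :
    ∃ S : Finset V,
      #(G.interedges S S) + #(G.interedges Sᶜ Sᶜ) ≤ 18 * Fintype.card V := by
  obtain ⟨u, v, -, h⟩ := hG.exists_adj_card_union hm
  refine ⟨G.neighborFinset u, ?_⟩
  have h_diff : #((G.neighborFinset u)ᶜ \ G.neighborFinset v) ≤ 3 := by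
    rw [sdiff_eq_inter_compl, ← compl_union, card_compl]
    lia
  have h_left := hG.card_interedges_neighborFinset_add_twelve u
  have h_right := hG.card_interedges_neighborFinset_add_twelve v
  have h_rest := card_interedges_self_le_add (G := G) (G.neighborFinset u)ᶜ (G.neighborFinset v)
  have hu := G.degree_lt_card_verts u
  have hv := G.degree_lt_card_verts v
  nlinarith

theorem balanced_of_le_four_mul {p q n C : ℕ} (hpq : p + q = n)
    (h : n ^ 2 ≤ 4 * (p * q) + 4 * C * n) (hn : 1000000 * C < n) : 499 * n ≤ 1000 * p := by
  by_contra! h_lt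
  subst hpq
  zify at h hn h_lt
  have h_diff : ((p : ℤ) + q) ^ 2 < (500 * ((q : ℤ) - p)) ^ 2 :=
    pow_lt_pow_left₀ (by lia) (by positivity) two_ne_zero
  nlinarith

theorem card_sdiff_rich_le {S T : Finset V} (hd : Disjoint S T)
    (h_miss : #(Gᶜ.interedges S T) ≤ 9 * Fintype.card V)
    (hT : 499 * Fintype.card V ≤ 1000 * #T) (hn : 0 < Fintype.card V) :
    #(S \ rich G T) ≤ 27 := by
  have h_poor : #(S \ rich G T) * Fintype.card V ≤ 3 * #(Gᶜ.interedges (S \ rich G T) T) := by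
    refine card_mul_le_mul_card_interedges fun x hx => ?_
    obtain ⟨hxS, hx⟩ := mem_sdiff.1 hx
    rw [mem_rich] at hx
    have := degIn_add_degIn_compl (G := G) (disjoint_left.1 hd hxS)
    lia
  have h_mono := card_le_card (Gᶜ.interedges_mono (sdiff_subset : S \ rich G T ⊆ S)
    (subset_refl T))
  refine Nat.le_of_mul_le_mul_right (h_poor.trans ?_) hn
  lia

theorem IsFlag3Manifold.degIn_mul_degIn_le (hG : IsFlag3Manifold G) {S T : Finset V}
    (hd : Disjoint S T) (hST : S ∪ T = univ) (x : V) :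
    degIn G x S * degIn G x T ≤ 2 * G.degree x + #(Gᶜ.interedges S T) := by
  have hd' := hd.mono (inter_subset_right : G.neighborFinset x ∩ S ⊆ S)
    (inter_subset_right : G.neighborFinset x ∩ T ⊆ T)
  have h_cross := hG.card_interedges_add_four_le hd'
    (by rw [← inter_union_distrib_left, hST, inter_univ])
  have h_compl := G.card_interedges_add_card_interedges_compl hd'
  have h_mono := card_le_card (Gᶜ.interedges_mono
    (inter_subset_right : G.neighborFinset x ∩ S ⊆ S)
    (inter_subset_right : G.neighborFinset x ∩ T ⊆ T))
  rw [degIn_eq_card_inter, degIn_eq_card_inter]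
  lia

theorem card_compl_union_rich_le {S T : Finset V} (hST : S ∪ T = univ) :
    #(rich G T ∪ rich G S)ᶜ ≤ #(S \ rich G T) + #(T \ rich G S) := by
  refine (card_le_card fun x => ?_).trans (card_union_le _ _)
  have := mem_union.1 (hST ▸ mem_univ x)
  simp only [mem_compl, mem_union, mem_sdiff]
  tauto

theorem degIn_rich_le {S T : Finset V} {x : V} (hST : S ∪ T = univ)
    (h_mul : degIn G x S * degIn G x T ≤ 11 * Fintype.card V)
    (hd : Disjoint (rich G T) (rich G S)) (hT : #(T \ rich G S) ≤ 27)
    (hn : 0 < Fintype.card V) (hx : x ∈ rich G T) : degIn G x (rich G T) ≤ 600 := by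
  have h_sub : rich G T \ S ⊆ T \ rich G S := by
    intro y hy
    obtain ⟨hy, hyS⟩ := mem_sdiff.1 hy
    exact mem_sdiff.2 ⟨(mem_union.1 (hST ▸ mem_univ y)).resolve_left hyS, disjoint_left.1 hd hy⟩
  have h_side := degIn_le_add_card_sdiff (G := G) x (rich G T) S
  have h_card := card_le_card h_sub
  rw [mem_rich] at hx
  have h_small : degIn G x S * Fintype.card V ≤ 550 * Fintype.card V := by
    nlinarith [Nat.mul_le_mul_left (degIn G x S) hx]
  have := Nat.le_of_mul_le_mul_right h_small hn
  lia

theorem le_mul_degIn_rich {S T : Finset V} {x : V} (hT : #(T \ rich G S) ≤ 27)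
    (hn : 10 ^ 4 ≤ Fintype.card V) (hx : x ∈ rich G T) :
    Fintype.card V ≤ 60 * degIn G x (rich G S) := by
  have := degIn_le_add_card_sdiff (G := G) x T (rich G S)
  rw [mem_rich] at hx
  lia

variable (G) in
/-- The dense flag 3-manifold `G` is almost bipartite with almost equal sides `A` and `B`; the few
vertices outside `A ∪ B` have small degree. The constants are not optimised. -/
structure IsDenseSplit (A B : Finset V) : Prop where
  manifold : IsFlag3Manifold G
  dense : Fintype.card V ^ 2 + 2 * Fintype.card V + 17 < 4 * #G.edgeFinset
  large : 10 ^ 10 ≤ Fintype.card V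
  disjoint : Disjoint A B
  card_left : 498 * Fintype.card V ≤ 1000 * #A
  card_right : 498 * Fintype.card V ≤ 1000 * #B
  card_rest : #(A ∪ B)ᶜ ≤ 54
  inner_left : ∀ x ∈ A, degIn G x A ≤ 600
  inner_right : ∀ x ∈ B, degIn G x B ≤ 600
  cross_left : ∀ x ∈ A, Fintype.card V ≤ 60 * degIn G x B
  cross_right : ∀ x ∈ B, Fintype.card V ≤ 60 * degIn G x A
  degree_rest : ∀ x ∈ (A ∪ B)ᶜ, 25 * G.degree x ≤ Fintype.card V

theorem IsDenseSplit.symm {A B : Finset V} (D : IsDenseSplit G A B) : IsDenseSplit G B A where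
  manifold := D.manifold
  dense := D.dense
  large := D.large
  disjoint := D.disjoint.symm
  card_left := D.card_right
  card_right := D.card_left
  card_rest := union_comm A B ▸ D.card_rest
  inner_left := D.inner_right
  inner_right := D.inner_left
  cross_left := D.cross_right
  cross_right := D.cross_left
  degree_rest := union_comm A B ▸ D.degree_rest

theorem card_interedges_compl_le_of_sparse_cut {S : Finset V}
    (hm : Fintype.card V ^ 2 < 4 * #G.edgeFinset)
    (hS : #(G.interedges S S) + #(G.interedges Sᶜ Sᶜ) ≤ 18 * Fintype.card V) :
    #(Gᶜ.interedges S Sᶜ) ≤ 9 * Fintype.card V ∧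
      Fintype.card V ^ 2 ≤ 4 * (#S * #Sᶜ) + 4 * 9 * Fintype.card V := by
  have h_edges := two_mul_card_edgeFinset_le (G := G) (disjoint_compl_right (a := S))
  rw [union_compl, compl_univ, sum_empty] at h_edges
  have h_compl := G.card_interedges_add_card_interedges_compl (disjoint_compl_right (a := S))
  have h_amgm := four_mul_le_sq_add #S #Sᶜ
  rw [card_add_card_compl] at h_amgm
  constructor <;> lia

theorem IsFlag3Manifold.exists_isDenseSplit (hG : IsFlag3Manifold G)
    (hm : Fintype.card V ^ 2 + 2 * Fintype.card V + 17 < 4 * #G.edgeFinset)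
    (hn : 10 ^ 10 ≤ Fintype.card V) : ∃ A B, IsDenseSplit G A B := by
  obtain ⟨S, hS⟩ := hG.exists_sparse_cut (by lia)
  obtain ⟨h_miss, h_prod⟩ := card_interedges_compl_le_of_sparse_cut (by lia) hS
  have hd : Disjoint S Sᶜ := disjoint_compl_right
  have hu : S ∪ Sᶜ = univ := union_compl S
  have hc : #S + #Sᶜ = Fintype.card V := card_add_card_compl S
  have hS_bal : 499 * Fintype.card V ≤ 1000 * #S := balanced_of_le_four_mul hc h_prod (by lia)
  have hT_bal : 499 * Fintype.card V ≤ 1000 * #Sᶜ :=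
    balanced_of_le_four_mul ((add_comm _ _).trans hc) (mul_comm #S _ ▸ h_prod) (by lia)
  have h_mul : ∀ x, degIn G x S * degIn G x Sᶜ ≤ 11 * Fintype.card V := fun x => by
    have := hG.degIn_mul_degIn_le hd hu x
    have := G.degree_lt_card_verts x
    lia
  generalize Sᶜ = T at *
  have h_rich := disjoint_rich h_mul (by lia)
  have hS_poor : #(S \ rich G T) ≤ 27 := card_sdiff_rich_le hd h_miss hT_bal (by lia)
  have hT_poor : #(T \ rich G S) ≤ 27 :=
    card_sdiff_rich_le hd.symm (card_interedges_comm (G := Gᶜ) S T ▸ h_miss) hS_bal (by lia)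
  refine ⟨rich G T, rich G S, hG, hm, hn, h_rich, ?_, ?_, ?_,
    fun x => degIn_rich_le hu (h_mul x) h_rich hT_poor (by lia),
    fun x => degIn_rich_le (union_comm S T ▸ hu) (mul_comm (degIn G x S) _ ▸ h_mul x)
      h_rich.symm hS_poor (by lia),
    fun x => le_mul_degIn_rich hT_poor (by lia), fun x => le_mul_degIn_rich hS_poor (by lia), ?_⟩
  · have := card_le_card_sdiff_add_card (s := S) (t := rich G T)
    lia
  · have := card_le_card_sdiff_add_card (s := T) (t := rich G S)
    lia
  · have := card_compl_union_rich_le (G := G) hu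
    lia
  · intro x hx
    simp only [mem_compl, mem_union, mem_rich, not_or, not_le] at hx
    rw [← degIn_univ, ← hu, degIn_union hd]
    lia

end DenseSplits

/-! ### Degrees inside the two sides -/

section InnerDegrees

variable {V : Type*} [Fintype V] [DecidableEq V] {G : SimpleGraph V} [DecidableRel G.Adj]

/-- The upper bound `2 * deg x - 4` for the number of edges between `P` and the other neighbours of
`x` forces many of the pairs between `P` and `B` to be non-adjacent. -/
theorem IsFlag3Manifold.card_add_two_mul_degIn_le (hG : IsFlag3Manifold G) {x : V}
    {P B : Finset V} (hP : P ⊆ G.neighborFinset x) (h_three : #P = 3)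
    (hd : Disjoint (insert x P) B) :
    #B + 2 * degIn G x B + 4 ≤ #(Gᶜ.interedges (insert x P) B) + 2 * G.degree x := by
  have hPB : Disjoint P B := hd.mono_left (subset_insert x P)
  have hx : x ∉ P := fun h => G.notMem_neighborFinset_self x (hP h)
  have h_cross := hG.card_interedges_add_four_le disjoint_sdiff (union_sdiff_of_subset hP)
  have h_sub : G.neighborFinset x ∩ B ⊆ G.neighborFinset x \ P := by
    intro y hy
    exact mem_sdiff.2 ⟨(mem_inter.1 hy).1, disjoint_right.1 hPB (mem_inter.1 hy).2⟩
  have h_mono := card_le_card (G.interedges_mono (subset_refl P) h_sub)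
  have h_mono' := card_le_card (Gᶜ.interedges_mono (subset_refl P)
    (inter_subset_right : G.neighborFinset x ∩ B ⊆ B))
  have h_compl := G.card_interedges_add_card_interedges_compl (hPB.mono_right inter_subset_right :
    Disjoint P (G.neighborFinset x ∩ B))
  have h_miss := degIn_add_degIn_compl (G := G) (disjoint_left.1 hd (mem_insert_self x P))
  rw [h_three, ← degIn_eq_card_inter] at h_compl
  rw [card_interedges_eq_sum_degIn, sum_insert hx, ← card_interedges_eq_sum_degIn]
  lia

namespace IsDenseSplit

variable {A B P : Finset V} {x y : V}

theorem card_add_card_rest (D : IsDenseSplit G A B) : #A + #B + #(A ∪ B)ᶜ = Fintype.card V := by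
  rw [← card_union_of_disjoint D.disjoint, card_add_card_compl]

theorem sum_degree_rest_le (D : IsDenseSplit G A B) :
    25 * ∑ x ∈ (A ∪ B)ᶜ, G.degree x ≤ #(A ∪ B)ᶜ * Fintype.card V := by
  rw [mul_sum, ← smul_eq_mul (#_), ← sum_const]
  exact sum_le_sum D.degree_rest

theorem sq_add_four_mul_card_missing_lt (D : IsDenseSplit G A B) :
    Fintype.card V ^ 2 + 2 * Fintype.card V + 17 + 4 * #(Gᶜ.interedges A B) <
      4 * (#A * #B) + 2 * (#(G.interedges A A) + #(G.interedges B B)) +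
        4 * ∑ x ∈ (A ∪ B)ᶜ, G.degree x := by
  have h_edges := two_mul_card_edgeFinset_le (G := G) D.disjoint
  have h_compl := G.card_interedges_add_card_interedges_compl D.disjoint
  have h_dense := D.dense
  lia

theorem degree_le (D : IsDenseSplit G A B) (x : V) :
    G.degree x ≤ degIn G x A + degIn G x B + #(A ∪ B)ᶜ := by
  rw [← degIn_univ, ← union_compl (A ∪ B), degIn_union disjoint_compl_right,
    degIn_union D.disjoint]
  exact Nat.add_le_add_left (degIn_le_card x _) _

theorem card_right_add_four_le (D : IsDenseSplit G A B) (hx : x ∈ A)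
    (hP : P ⊆ G.neighborFinset x ∩ A) (h_three : #P = 3) :
    #B + 4 ≤ #(Gᶜ.interedges (insert x P) B) + 2 * (degIn G x A + #(A ∪ B)ᶜ) := by
  obtain ⟨hPN, hPA⟩ := subset_inter_iff.1 hP
  have h_excess := D.manifold.card_add_two_mul_degIn_le hPN h_three
    (D.disjoint.mono_left (insert_subset hx hPA))
  have h_degree := D.degree_le x
  lia

theorem card_missing_le (D : IsDenseSplit G A B) :
    #(Gᶜ.interedges A B) ≤ 310 * Fintype.card V := by
  have h_count := D.sq_add_four_mul_card_missing_lt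
  have h_left := card_interedges_le_card_mul D.inner_left
  have h_right := card_interedges_le_card_mul D.inner_right
  have h_rest := D.sum_degree_rest_le.trans (Nat.mul_le_mul_right _ D.card_rest)
  have h_card := D.card_add_card_rest
  have h_amgm := four_mul_le_sq_add #A #B
  have h_sq : (#A + #B) ^ 2 ≤ Fintype.card V ^ 2 := Nat.pow_le_pow_left (by lia) 2
  lia

/-- The vertices of `A` missing at most a tenth of the vertices in `B`. -/
def goodSet (G : SimpleGraph V) [DecidableRel G.Adj] (A B : Finset V) : Finset V :=
  {a ∈ A | 10 * degIn Gᶜ a B ≤ Fintype.card V}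

theorem card_sdiff_goodSet_le (D : IsDenseSplit G A B) : #(A \ goodSet G A B) ≤ 3100 := by
  have h_bad : #(A \ goodSet G A B) * Fintype.card V ≤
      10 * #(Gᶜ.interedges (A \ goodSet G A B) B) := by
    refine card_mul_le_mul_card_interedges fun x hx => ?_
    simp only [goodSet, mem_sdiff, mem_filter, not_and, not_le] at hx
    exact (hx.2 hx.1).le
  have h_mono := card_le_card (Gᶜ.interedges_mono (sdiff_subset : A \ goodSet G A B ⊆ A)
    (subset_refl B))
  have h_miss := D.card_missing_le
  have h_large := D.large
  refine Nat.le_of_mul_le_mul_right (h_bad.trans ?_) (by lia : 0 < Fintype.card V)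
  lia

theorem degIn_goodSet_le_two (D : IsDenseSplit G A B) (hx : x ∈ goodSet G A B) :
    degIn G x (goodSet G A B) ≤ 2 := by
  by_contra! h
  have h_good : goodSet G A B ⊆ A := filter_subset _ _
  rw [degIn_eq_card_inter] at h
  obtain ⟨P, hP, h_three⟩ := exists_subset_card_eq (Nat.succ_le_of_lt h)
  have h_excess := D.card_right_add_four_le (h_good hx)
    (hP.trans (inter_subset_inter_left h_good)) h_three
  have h_miss : 10 * #(Gᶜ.interedges (insert x P) B) ≤ 4 * Fintype.card V := by
    have h_card : #(insert x P) ≤ 4 := (card_insert_le x P).trans (by lia)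
    rw [card_interedges_eq_sum_degIn, mul_sum]
    refine (sum_le_card_nsmul _ _ (Fintype.card V) fun y hy => ?_).trans
      (Nat.mul_le_mul_right _ h_card)
    have hy : y ∈ goodSet G A B :=
      insert_subset hx (hP.trans inter_subset_right) hy
    exact (mem_filter.1 hy).2
  have h_inner := D.inner_left x (h_good hx)
  have h_rest := D.card_rest
  have h_card := D.card_right
  have h_large := D.large
  lia

theorem card_inner_le (D : IsDenseSplit G A B) :
    1000 * #(G.interedges A A) ≤ 2000 * #A + Fintype.card V := by
  have h_good : goodSet G A B ⊆ A := filter_subset _ _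
  have h_sub : G.interedges A A ⊆ G.interedges (goodSet G A B) (goodSet G A B) ∪
      (G.interedges (A \ goodSet G A B) A ∪ G.interedges A (A \ goodSet G A B)) := by
    rintro ⟨x, y⟩
    simp only [SimpleGraph.mem_interedges_iff, mem_union, mem_sdiff]
    tauto
  have h_union := (card_le_card h_sub).trans ((card_union_le _ _).trans
    (Nat.add_le_add_left (card_union_le _ _) _))
  have h_good_le := card_interedges_le_card_mul (G := G) fun x hx => D.degIn_goodSet_le_two hx
  have h_bad_le := card_interedges_le_card_mul (G := G) (S := A \ goodSet G A B)
    fun x hx => D.inner_left x (mem_sdiff.1 hx).1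
  have h_comm := card_interedges_comm (G := G) A (A \ goodSet G A B)
  have h_bad := D.card_sdiff_goodSet_le
  have h_card := card_le_card h_good
  have h_large := D.large
  lia

theorem thousand_mul_sq_add_lt (D : IsDenseSplit G A B) :
    1000 * (Fintype.card V ^ 2 + 2 * Fintype.card V + 4 * #(Gᶜ.interedges A B)) <
      1000 * (#A + #B) ^ 2 + 4000 * (#A + #B) + 4 * Fintype.card V +
        160 * (#(A ∪ B)ᶜ * Fintype.card V) := by
  have h_count := D.sq_add_four_mul_card_missing_lt
  have h_left := D.card_inner_le
  have h_right := D.symm.card_inner_le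
  have h_rest := D.sum_degree_rest_le
  have h_amgm := four_mul_le_sq_add #A #B
  lia

theorem card_rest_le_one (D : IsDenseSplit G A B) : #(A ∪ B)ᶜ ≤ 1 := by
  have h_count := D.thousand_mul_sq_add_lt
  have h_rest := D.card_rest
  have h_large := D.large
  by_contra! h
  rw [← D.card_add_card_rest] at *
  generalize #A + #B = s at *
  generalize #(A ∪ B)ᶜ = r at *
  nlinarith

theorem card_missing_le_of_card_rest_eq_one (D : IsDenseSplit G A B) (h : #(A ∪ B)ᶜ = 1) :
    20 * #(Gᶜ.interedges A B) ≤ Fintype.card V := by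
  have h_count := D.thousand_mul_sq_add_lt
  have h_large := D.large
  rw [h] at h_count
  have h_card := D.card_add_card_rest
  rw [h] at h_card
  rw [← h_card] at h_count h_large ⊢
  nlinarith

theorem card_missing_le_of_cover (D : IsDenseSplit G A B) (h : A ∪ B = univ) :
    1000 * #(Gᶜ.interedges A B) ≤ 501 * Fintype.card V := by
  have h_count := D.thousand_mul_sq_add_lt
  have h_card := D.card_add_card_rest
  rw [h, compl_univ, card_empty] at h_count h_card
  rw [← h_card, add_zero] at h_count ⊢
  lia

theorem inner_le_two_of_card_rest_eq_one (D : IsDenseSplit G A B) (h : #(A ∪ B)ᶜ = 1)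
    (hx : x ∈ A) : degIn G x A ≤ 2 := by
  by_contra! h_lt
  rw [degIn_eq_card_inter] at h_lt
  obtain ⟨P, hP, h_three⟩ := exists_subset_card_eq (Nat.succ_le_of_lt h_lt)
  have h_excess := D.card_right_add_four_le hx hP h_three
  have h_mono := card_le_card (Gᶜ.interedges_mono
    (insert_subset hx (hP.trans inter_subset_right)) (subset_refl B))
  have h_miss := D.card_missing_le_of_card_rest_eq_one h
  have h_inner := D.inner_left x hx
  have h_card := D.card_right
  have h_large := D.large
  lia

/-- The density leaves room for about `n / 2` missing edges between the sides, and the link of `x`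
uses up about `#B ≥ 0.498 * n` of them at `insert x P`. -/
theorem card_missing_sdiff_le (D : IsDenseSplit G A B) (h : A ∪ B = univ) (hx : x ∈ A)
    (hP : P ⊆ G.neighborFinset x ∩ A) (h_three : #P = 3) :
    250 * #(Gᶜ.interedges (A \ insert x P) B) ≤ Fintype.card V := by
  have h_excess := D.card_right_add_four_le hx hP h_three
  have h_miss := D.card_missing_le_of_cover h
  rw [← union_sdiff_of_subset (insert_subset hx (hP.trans inter_subset_right)),
    card_interedges_union_left disjoint_sdiff] at h_miss
  have h_inner := D.inner_left x hx
  have h_card := D.card_right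
  have h_large := D.large
  rw [h, compl_univ, card_empty] at h_excess
  lia

theorem degIn_compl_le_of_notMem (D : IsDenseSplit G A B) (h : A ∪ B = univ) (hx : x ∈ A)
    (hP : P ⊆ G.neighborFinset x ∩ A) (h_three : #P = 3) (hy : y ∈ A \ insert x P) :
    200 * degIn Gᶜ y B ≤ Fintype.card V := by
  have h_miss := D.card_missing_sdiff_le h hx hP h_three
  have h_le := degIn_le_card_interedges (G := Gᶜ) hy B
  lia

theorem degIn_compl_le_of_mem_right (D : IsDenseSplit G A B) (h : A ∪ B = univ) (hx : x ∈ A)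
    (hP : P ⊆ G.neighborFinset x ∩ A) (h_three : #P = 3) (hy : y ∈ B) :
    200 * degIn Gᶜ y A ≤ Fintype.card V := by
  have h_miss := D.card_missing_sdiff_le h hx hP h_three
  have h_le := degIn_le_card_interedges (G := Gᶜ) hy (A \ insert x P)
  have h_four := (degIn_le_card (G := Gᶜ) y (insert x P)).trans (card_insert_le x P)
  have h_large := D.large
  rw [← union_sdiff_of_subset (insert_subset hx (hP.trans inter_subset_right)),
    degIn_union disjoint_sdiff]
  rw [card_interedges_comm] at h_miss
  lia

theorem exists_lt_degIn_compl (D : IsDenseSplit G A B) (h : A ∪ B = univ) (hx : x ∈ A)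
    (hP : P ⊆ G.neighborFinset x ∩ A) (h_three : #P = 3) (hy : y ∈ insert x P) :
    ∃ u ∈ (insert x P).erase y, Fintype.card V < 200 * degIn Gᶜ u B := by
  by_contra! h_all
  have hW : insert x P ⊆ A := insert_subset hx (hP.trans inter_subset_right)
  have h_excess := D.card_right_add_four_le hx hP h_three
  have h_card : #((insert x P).erase y) ≤ 3 := by
    have := card_insert_le x P
    rw [card_erase_of_mem hy]
    lia
  have h_sum := (sum_le_card_nsmul _ _ _ h_all).trans (Nat.mul_le_mul_right _ h_card)
  rw [← mul_sum, ← card_interedges_eq_sum_degIn] at h_sum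
  have h_cross := D.cross_left y (hW hy)
  have h_miss := degIn_add_degIn_compl (G := G) (disjoint_left.1 D.disjoint (hW hy))
  have h_inner := D.inner_left x hx
  have h_large := D.large
  rw [h, compl_univ, card_empty, card_interedges_eq_sum_degIn, ← add_sum_erase _ _ hy,
    ← card_interedges_eq_sum_degIn] at h_excess
  lia

theorem inner_le_three (D : IsDenseSplit G A B) (h : A ∪ B = univ) (hx : x ∈ A) :
    degIn G x A ≤ 3 := by
  by_contra! h_lt
  rw [degIn_eq_card_inter] at h_lt
  obtain ⟨Q, hQ, h_four⟩ := exists_subset_card_eq (Nat.succ_le_of_lt h_lt)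
  obtain ⟨P, hPQ, h_three⟩ := exists_subset_card_eq (by lia : 3 ≤ #Q)
  obtain ⟨u, hu, h_bad⟩ := D.exists_lt_degIn_compl h hx (hPQ.trans hQ) h_three
    (mem_insert_self x P)
  obtain ⟨hux, huP⟩ := mem_erase.1 hu
  have huQ : u ∈ Q := hPQ ((mem_insert.1 huP).resolve_left hux)
  refine h_bad.not_ge (D.degIn_compl_le_of_notMem h hx ((erase_subset u Q).trans hQ) ?_ ?_)
  · rw [card_erase_of_mem huQ, h_four]
  · exact mem_sdiff.2 ⟨(mem_inter.1 (hQ huQ)).2, by simp [hux]⟩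

theorem card_filter_excess_le (D : IsDenseSplit G A B) (h : A ∪ B = univ) :
    #{x ∈ A | 3 ≤ degIn G x A} ≤ 4 := by
  rcases eq_empty_or_nonempty {x ∈ A | 3 ≤ degIn G x A} with h_empty | ⟨x, hx⟩
  · rw [h_empty, card_empty]
    exact Nat.zero_le _
  have h_nbrs : ∀ y ∈ A, 3 ≤ degIn G y A → #(G.neighborFinset y ∩ A) = 3 := by
    intro y hy h_ge
    rw [← degIn_eq_card_inter]
    exact le_antisymm (D.inner_le_three h hy) h_ge
  obtain ⟨hx, h_ge⟩ := mem_filter.1 hx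
  obtain ⟨u, hu, h_bad⟩ := D.exists_lt_degIn_compl h hx subset_rfl (h_nbrs x hx h_ge)
    (mem_insert_self x _)
  have huA : u ∈ A := insert_subset hx inter_subset_right (mem_erase.1 hu).2
  have h_sub : {x ∈ A | 3 ≤ degIn G x A} ⊆ insert u (G.neighborFinset u ∩ A) := by
    intro y hy
    obtain ⟨hy, h_ge⟩ := mem_filter.1 hy
    have h_mem : u ∈ insert y (G.neighborFinset y ∩ A) := by
      by_contra h_not
      exact h_bad.not_ge (D.degIn_compl_le_of_notMem h hy subset_rfl (h_nbrs y hy h_ge)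
        (mem_sdiff.2 ⟨huA, h_not⟩))
    simp only [mem_insert, mem_inter, SimpleGraph.mem_neighborFinset] at h_mem ⊢
    exact h_mem.imp Eq.symm fun hyu => ⟨hyu.1.symm, hy⟩
  refine (card_le_card h_sub).trans ((card_insert_le _ _).trans ?_)
  have := D.inner_le_three h huA
  rw [degIn_eq_card_inter] at this
  lia

theorem inner_right_le_two_of_excess (D : IsDenseSplit G A B) (h : A ∪ B = univ) (hx : x ∈ A)
    (hP : P ⊆ G.neighborFinset x ∩ A) (h_three : #P = 3) (hy : y ∈ B) : degIn G y B ≤ 2 := by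
  by_contra! h_lt
  rw [degIn_eq_card_inter] at h_lt
  obtain ⟨Q, hQ, hQ_three⟩ := exists_subset_card_eq (Nat.succ_le_of_lt h_lt)
  obtain ⟨u, hu, h_bad⟩ := D.symm.exists_lt_degIn_compl (union_comm A B ▸ h) hy hQ hQ_three
    (mem_insert_self y Q)
  have huB : u ∈ B := insert_subset hy (hQ.trans inter_subset_right) (mem_erase.1 hu).2
  exact h_bad.not_ge (D.degIn_compl_le_of_mem_right h hx hP h_three huB)

theorem inner_le_two_of_cover (D : IsDenseSplit G A B) (h : A ∪ B = univ) (hx : x ∈ A) :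
    degIn G x A ≤ 2 := by
  by_contra! h_lt
  rw [degIn_eq_card_inter] at h_lt
  obtain ⟨P, hP, h_three⟩ := exists_subset_card_eq (Nat.succ_le_of_lt h_lt)
  have h_left : #(G.interedges A A) ≤ 2 * #A + 4 := by
    have h_point : ∀ y ∈ A, degIn G y A ≤ 2 + if 3 ≤ degIn G y A then 1 else 0 := by
      intro y hy
      have := D.inner_le_three h hy
      split_ifs <;> lia
    have h_excess := D.card_filter_excess_le h
    rw [card_filter] at h_excess
    rw [card_interedges_eq_sum_degIn]
    refine (sum_le_sum h_point).trans ?_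
    rw [sum_add_distrib, sum_const, smul_eq_mul]
    lia
  have h_right := card_interedges_le_card_mul (G := G) fun y hy =>
    D.inner_right_le_two_of_excess h hx hP h_three hy
  have h_miss := D.card_right_add_four_le hx hP h_three
  have h_mono := card_le_card (Gᶜ.interedges_mono
    (insert_subset hx (hP.trans inter_subset_right)) (subset_refl B))
  have h_three_le := D.inner_le_three h hx
  have h_count := D.sq_add_four_mul_card_missing_lt
  rw [← D.card_add_card_rest, h, compl_univ, sum_empty, card_empty] at h_count
  rw [h, compl_univ, card_empty] at h_miss
  zify at *
  nlinarith [sq_nonneg ((#A : ℤ) - #B - 1)]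

theorem inner_le_two (D : IsDenseSplit G A B) (hx : x ∈ A) : degIn G x A ≤ 2 := by
  rcases Nat.le_one_iff_eq_zero_or_eq_one.1 D.card_rest_le_one with h | h
  · exact D.inner_le_two_of_cover ((compl_eq_empty_iff _).1 (card_eq_zero.1 h)) hx
  · exact D.inner_le_two_of_card_rest_eq_one h hx

end IsDenseSplit

end InnerDegrees

/-! ### Edge links spanning the two sides -/

section SpanningPair

variable {V : Type*} [Fintype V] [DecidableEq V] {G : SimpleGraph V} [DecidableRel G.Adj]

namespace IsDenseSplit

variable {A B : Finset V} {a b x : V}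

theorem neighborFinset_inter_subset_neighborFinset (D : IsDenseSplit G A B) (ha : a ∈ A)
    (hb : b ∈ B) (hN : G.neighborFinset a ⊆ A ∪ B) (hab : G.Adj a b) :
    2 ≤ #(G.neighborFinset a ∩ A) ∧ G.neighborFinset a ∩ A ⊆ G.neighborFinset b := by
  have h_sub : edgeLink G a b ⊆
      G.neighborFinset a ∩ A ∩ G.neighborFinset b ∪ G.neighborFinset b ∩ B := by
    intro y hy
    have hyN := hN ((G.mem_neighborFinset a y).2 (mem_edgeLink.1 hy).1)
    simp only [mem_union, mem_inter, SimpleGraph.mem_neighborFinset] at hy hyN ⊢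
    tauto
  have h_four := (D.manifold.four_le_card_edgeLink hab).trans
    ((card_le_card h_sub).trans (card_union_le _ _))
  have h_a := D.inner_le_two ha
  have h_b := D.symm.inner_le_two hb
  rw [degIn_eq_card_inter] at h_a h_b
  have h_two : 2 ≤ #(G.neighborFinset a ∩ A ∩ G.neighborFinset b) := by lia
  exact ⟨h_two.trans (card_le_card inter_subset_left),
    inter_eq_left.1 (eq_of_subset_of_card_le inter_subset_left (h_a.trans h_two))⟩

theorem exists_edgeLink_eq_neighborFinset_inter (D : IsDenseSplit G A B) (ha : a ∈ A)
    (hN : G.neighborFinset a ⊆ A ∪ B) :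
    ∃ a', G.Adj a a' ∧ edgeLink G a a' = G.neighborFinset a ∩ B := by
  have h_full : ∀ b ∈ G.neighborFinset a ∩ B,
      2 ≤ #(G.neighborFinset a ∩ A) ∧ G.neighborFinset a ∩ A ⊆ G.neighborFinset b := by
    intro b hb
    obtain ⟨hab, hb⟩ := mem_inter.1 hb
    exact D.neighborFinset_inter_subset_neighborFinset ha hb hN ((G.mem_neighborFinset a b).1 hab)
  have h_three : 2 < #(G.neighborFinset a ∩ B) := by
    have h_cross := D.cross_left a ha
    have h_large := D.large
    rw [degIn_eq_card_inter] at h_cross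
    lia
  obtain ⟨b, hb⟩ := card_pos.1 (pos_of_gt h_three)
  obtain ⟨a', ha'⟩ := card_pos.1 (two_pos.trans_le (h_full b hb).1)
  have haa' : G.Adj a a' := (G.mem_neighborFinset a a').1 (mem_inter.1 ha').1
  have h_adj : ∀ y ∈ G.neighborFinset a ∩ A, G.neighborFinset a ∩ B ⊆ G.neighborFinset y := by
    intro y hy b hb
    have := (h_full b hb).2 hy
    rwa [SimpleGraph.mem_neighborFinset, G.adj_comm, ← SimpleGraph.mem_neighborFinset] at this
  refine ⟨a', haa', Subset.antisymm (fun x hx => ?_) fun b hb => ?_⟩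
  · obtain ⟨hax, ha'x⟩ := mem_edgeLink.1 hx
    rw [← SimpleGraph.mem_neighborFinset] at hax
    refine mem_inter.2 ⟨hax, (mem_union.1 (hN hax)).resolve_left fun hxA => ?_⟩
    have h_sub : G.neighborFinset a ∩ B ⊆ edgeLink G a a' ∩ G.neighborFinset x :=
      subset_inter (subset_inter inter_subset_left (h_adj a' ha'))
        (h_adj x (mem_inter.2 ⟨hax, hxA⟩))
    have h_two := D.manifold.card_edgeLink_inter_neighborFinset haa'
      ((G.mem_neighborFinset a x).1 hax) ha'x
    exact h_three.not_ge (h_two ▸ card_le_card h_sub)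
  · exact subset_inter inter_subset_left (h_adj a' ha') hb

theorem two_mul_card_missing_lt (D : IsDenseSplit G A B) (h : A ∪ B = univ) :
    2 * #(Gᶜ.interedges A B) < Fintype.card V := by
  have h_left := card_interedges_le_card_mul (G := G) fun x hx => D.inner_le_two (x := x) hx
  have h_right := card_interedges_le_card_mul (G := G) fun x hx => D.symm.inner_le_two (x := x) hx
  have h_count := D.sq_add_four_mul_card_missing_lt
  have h_card := D.card_add_card_rest
  have h_amgm := four_mul_le_sq_add #A #B
  rw [h, compl_univ, card_empty] at h_card
  rw [h, compl_univ, sum_empty, ← h_card] at h_count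
  lia

theorem exists_degIn_compl_eq_zero_of_card_rest_eq_one (D : IsDenseSplit G A B)
    (h : #(A ∪ B)ᶜ = 1) :
    ∃ a ∈ A, G.neighborFinset a ⊆ A ∪ B ∧ degIn Gᶜ a B = 0 := by
  obtain ⟨z, hz⟩ := card_eq_one.1 h
  have h_few : #(Gᶜ.interedges (A \ G.neighborFinset z) B) <
      #(A \ G.neighborFinset z) * (0 + 1) := by
    have h_mono := card_le_card (Gᶜ.interedges_mono
      (sdiff_subset : A \ G.neighborFinset z ⊆ A) (subset_refl B))
    have h_miss := D.card_missing_le_of_card_rest_eq_one h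
    have h_sdiff := le_card_sdiff (G.neighborFinset z) A
    have h_degree := D.degree_rest z (hz ▸ mem_singleton_self z)
    have h_card := D.card_left
    have h_large := D.large
    rw [SimpleGraph.card_neighborFinset_eq_degree] at h_sdiff
    lia
  obtain ⟨a, ha, h_zero⟩ := exists_degIn_le h_few
  obtain ⟨ha, haz⟩ := mem_sdiff.1 ha
  refine ⟨a, ha, fun y hy => ?_, Nat.le_zero.1 h_zero⟩
  by_contra h_rest
  rw [← mem_compl, hz, mem_singleton] at h_rest
  rw [SimpleGraph.mem_neighborFinset] at haz hy
  exact haz (h_rest ▸ hy.symm)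

theorem exists_almost_complete_pair (D : IsDenseSplit G A B) :
    ∃ a ∈ A, ∃ b ∈ B, G.neighborFinset a ⊆ A ∪ B ∧ G.neighborFinset b ⊆ A ∪ B ∧
      degIn Gᶜ a B + degIn Gᶜ b A + #(A ∪ B)ᶜ ≤ 1 := by
  rcases Nat.le_one_iff_eq_zero_or_eq_one.1 D.card_rest_le_one with h | h
  · have h_cover : A ∪ B = univ := (compl_eq_empty_iff _).1 (card_eq_zero.1 h)
    have h_miss := D.two_mul_card_missing_lt h_cover
    have h_miss' := h_miss
    rw [card_interedges_comm] at h_miss'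
    have h_card := D.card_add_card_rest
    have h_left := D.card_left
    have h_right := D.card_right
    have h_large := D.large
    simp only [h_cover, subset_univ, true_and, compl_univ, card_empty] at h_card ⊢
    rcases le_total #A #B with h_le | h_le
    · obtain ⟨a, ha, ha_one⟩ := exists_degIn_le (G := Gᶜ) (S := A) (T := B) (k := 1) (by lia)
      obtain ⟨b, hb, hb_zero⟩ := exists_degIn_le (G := Gᶜ) (S := B) (T := A) (k := 0) (by lia)
      exact ⟨a, ha, b, hb, by lia⟩
    · obtain ⟨a, ha, ha_zero⟩ := exists_degIn_le (G := Gᶜ) (S := A) (T := B) (k := 0) (by lia)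
      obtain ⟨b, hb, hb_one⟩ := exists_degIn_le (G := Gᶜ) (S := B) (T := A) (k := 1) (by lia)
      exact ⟨a, ha, b, hb, by lia⟩
  · obtain ⟨a, ha, haN, ha_zero⟩ := D.exists_degIn_compl_eq_zero_of_card_rest_eq_one h
    obtain ⟨b, hb, hbN, hb_zero⟩ :=
      D.symm.exists_degIn_compl_eq_zero_of_card_rest_eq_one (union_comm A B ▸ h)
    exact ⟨a, ha, b, hb, haN, union_comm B A ▸ hbN, by lia⟩

theorem not_subset_neighborFinset (D : IsDenseSplit G A B) (ha : a ∈ A) (hb : b ∈ B)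
    (hab : degIn Gᶜ a B + degIn Gᶜ b A + #(A ∪ B)ᶜ ≤ 1) (hx : x ∉ G.neighborFinset b ∩ A) :
    ¬ G.neighborFinset a ∩ B ⊆ G.neighborFinset x := by
  intro h_sub
  have h_le : degIn G a B ≤ degIn G x B := by
    rw [degIn_eq_card_inter, degIn_eq_card_inter]
    exact card_le_card (subset_inter h_sub inter_subset_right)
  have h_miss := degIn_add_degIn_compl (G := G) (disjoint_left.1 D.disjoint ha)
  have h_large := D.large
  have h_card := D.card_right
  by_cases hxB : x ∈ B
  · have := D.inner_right x hxB
    lia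
  by_cases hxA : x ∈ A
  · have h_not : ∀ {u v : V} {S : Finset V}, v ∈ S → u ≠ v → ¬ G.Adj u v → 0 < degIn Gᶜ u S := by
      intro u v S hv h_ne h_nadj
      exact card_pos.2 ⟨v, mem_filter.2 ⟨hv, (G.compl_adj u v).2 ⟨h_ne, h_nadj⟩⟩⟩
    have h_bx : ¬ G.Adj b x := fun h => hx (mem_inter.2 ⟨(G.mem_neighborFinset b x).2 h, hxA⟩)
    have h_b := h_not hxA (ne_of_mem_of_not_mem hb hxB) h_bx
    have h_ab : G.Adj a b := by
      by_contra h
      have := h_not hb (D.disjoint.forall_ne_finset ha hb) h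
      lia
    exact h_bx ((G.mem_neighborFinset x b).1 (h_sub
      (mem_inter.2 ⟨(G.mem_neighborFinset a b).2 h_ab, hb⟩))).symm
  · have h_rest := D.degree_rest x (by simp [hxA, hxB])
    have := degIn_le_degree (G := G) x B
    lia

theorem card_compl_neighborFinset_union_le (D : IsDenseSplit G A B) (ha : a ∈ A) (hb : b ∈ B) :
    #(G.neighborFinset b ∩ A ∪ G.neighborFinset a ∩ B)ᶜ ≤
      degIn Gᶜ a B + degIn Gᶜ b A + #(A ∪ B)ᶜ := by
  have h_compl := card_add_card_compl (G.neighborFinset b ∩ A ∪ G.neighborFinset a ∩ B)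
  rw [card_union_of_disjoint (D.disjoint.mono inter_subset_right inter_subset_right),
    ← degIn_eq_card_inter, ← degIn_eq_card_inter] at h_compl
  have h_a := degIn_add_degIn_compl (G := G) (disjoint_left.1 D.disjoint ha)
  have h_b := degIn_add_degIn_compl (G := G) (disjoint_right.1 D.disjoint hb)
  have h_card := D.card_add_card_rest
  lia

end IsDenseSplit

end SpanningPair

end FlagGraph

theorem theorem1p5_general {V : Type*} [Fintype V] [DecidableEq V] (G : SimpleGraph V)
    [DecidableRel G.Adj] (hG : FlagGraph.IsFlag3Manifold G) (hn : 10 ^ 10 ≤ Fintype.card V)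
    (hm : Fintype.card V ^ 2 + 2 * Fintype.card V + 17 < 4 * #G.edgeFinset) :
    FlagGraph.IsJoinOfTwoCycles G := by
  obtain ⟨A, B, D⟩ := hG.exists_isDenseSplit hm hn
  obtain ⟨a, ha, b, hb, haN, hbN, hab⟩ := D.exists_almost_complete_pair
  obtain ⟨a', haa', h_left⟩ := D.exists_edgeLink_eq_neighborFinset_inter ha haN
  obtain ⟨b', hbb', h_right⟩ :=
    D.symm.exists_edgeLink_eq_neighborFinset_inter hb (union_comm A B ▸ hbN)
  refine hG.isJoinOfTwoCycles_of_card_compl_le_one haa' hbb' ?_ ?_ ?_ hm <;> rw [h_left, h_right]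
  · exact D.disjoint.mono inter_subset_right inter_subset_right
  · exact (D.card_compl_neighborFinset_union_le ha hb).trans hab
  · intro x hx
    rw [mem_union, not_or] at hx
    exact ⟨D.symm.not_subset_neighborFinset hb ha (by rw [union_comm]; lia) hx.2,
      D.not_subset_neighborFinset ha hb hab hx.1⟩

theorem theorem1p5 :
    ∃ n₀ : ℕ, ∀ (V : Type*) [Fintype V] [DecidableEq V] (G : SimpleGraph V) [DecidableRel G.Adj],
      FlagGraph.IsFascinating G →
      n₀ ≤ Fintype.card V →
      (G.edgeFinset.card : ℝ) > ((Fintype.card V : ℝ) ^ 2 + 2 * (Fintype.card V : ℝ) + 17) / 4 →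
      FlagGraph.IsJoinOfTwoCycles G := by
  refine ⟨10 ^ 10, fun V _ _ G _ hG hn hm => theorem1p5_general G hG.isFlag3Manifold hn ?_⟩
  have h : (Fintype.card V : ℝ) ^ 2 + 2 * Fintype.card V + 17 < 4 * #G.edgeFinset := by linarith
  exact_mod_cast h
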